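/- Let $n\ge 3$ and let $(M,g)$ be a smooth $n$-dimensional Riemannian manifold without boundary ($g$ positive definite). Let $R$ be its curvature tensor, $\mathsf{Ri}_{jk}=R^i_{ijk}$ its Ricci tensor, $\mathsf{sc}=g^{jk}\mathsf{Ri}_{jk}$ its scalar curvature, $S=\mathsf{Ri}-\frac{\mathsf{sc}}{2n-2}\,g$ its Schouten tensor and $C_{ijk}=S_{ij;k}-S_{ik;j}$ its Cotton tensor, where "$;$" denotes the covariant derivative of the Levi-Civita connection. Assume that $\mathsf{Ri}\not\equiv 0$ on every connected component of $M$ (for connected $M$: $\mathsf{Ri}$ is not identically zero). Then the following two conditions cannot hold at the same time: - $\mathsf{RR}$ (Ricci recurrent): there is a smooth one-form $\beta$ on $M$, not identically zero, such that $\mathsf{Ri}_{ij;\ell}=\beta_\ell\,\mathsf{Ri}_{ij}$; - $\mathsf{CO}$ (Cotton): $C=0$ identically on $M$. Equivalently, if $\mathsf{Ri}$ is Ricci recurrent, then the Cotton tensor of $g$ does not vanish identically. -/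

import Mathlib

open Bundle
open scoped Manifold ContDiff

noncomputable section

/-! ### Tensor calculus of a metric `G` given by its components on an open subset of `ℝⁿ`

`G x` is the matrix `(g_{ij}(x))`. A covariant 2-tensor is a function `T i j x`. -/

namespace LocalMetric

variable {n : ℕ}

/-- The partial derivative `∂f/∂x^k`. -/
def pderiv (k : Fin n) (f : EuclideanSpace ℝ (Fin n) → ℝ) (x : EuclideanSpace ℝ (Fin n)) : ℝ :=
  fderiv ℝ f x (EuclideanSpace.single k 1)

variable (G : EuclideanSpace ℝ (Fin n) → Matrix (Fin n) (Fin n) ℝ)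

/-- The Christoffel symbols
`Γ^k_{ij} = (1/2) g^{kl} (∂_i g_{jl} + ∂_j g_{il} - ∂_l g_{ij})`. -/
def christoffel (k i j : Fin n) (x : EuclideanSpace ℝ (Fin n)) : ℝ :=
  (1 / 2) * ∑ l, (G x)⁻¹ k l *
    (pderiv i (fun y => G y j l) x + pderiv j (fun y => G y i l) x
      - pderiv l (fun y => G y i j) x)

/-- The curvature tensor `R^l_{ijk}`, where `R(∂_i, ∂_j) ∂_k = R^l_{ijk} ∂_l` and
`R(X, Y) Z = ∇_X ∇_Y Z - ∇_Y ∇_X Z - ∇_{[X, Y]} Z`. -/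
def curvature (l i j k : Fin n) (x : EuclideanSpace ℝ (Fin n)) : ℝ :=
  pderiv i (christoffel G l j k) x - pderiv j (christoffel G l i k) x
    + ∑ s, (christoffel G l i s x * christoffel G s j k x
      - christoffel G l j s x * christoffel G s i k x)

/-- The Ricci tensor `Ri_{jk} = R^i_{ijk}`. -/
def ricci (j k : Fin n) (x : EuclideanSpace ℝ (Fin n)) : ℝ :=
  ∑ i, curvature G i i j k x

/-- The scalar curvature `sc = g^{jk} Ri_{jk}`. -/
def scalar (x : EuclideanSpace ℝ (Fin n)) : ℝ :=
  ∑ j, ∑ k, (G x)⁻¹ j k * ricci G j k x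

/-- The covariant derivative `T_{ij;l} = ∂_l T_{ij} - Γ^s_{li} T_{sj} - Γ^s_{lj} T_{is}`
of a covariant 2-tensor. -/
def covDeriv (T : Fin n → Fin n → EuclideanSpace ℝ (Fin n) → ℝ) (i j l : Fin n)
    (x : EuclideanSpace ℝ (Fin n)) : ℝ :=
  pderiv l (T i j) x
    - ∑ s, (christoffel G s l i x * T s j x + christoffel G s l j x * T i s x)

/-- The Schouten tensor `S = Ri - sc / (2n - 2) g`. -/
def schouten (i j : Fin n) (x : EuclideanSpace ℝ (Fin n)) : ℝ :=
  ricci G i j x - scalar G x / (2 * (n : ℝ) - 2) * G x i j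

/-- The Cotton tensor `C_{ijk} = S_{ij;k} - S_{ik;j}`. -/
def cotton (i j k : Fin n) (x : EuclideanSpace ℝ (Fin n)) : ℝ :=
  covDeriv G (schouten G) i j k x - covDeriv G (schouten G) i k j x

end LocalMetric

/-! ### Riemannian manifolds

`M` is a smooth `n`-dimensional manifold without boundary and `g` a smooth Riemannian metric on it.
Identities between tensor fields are identities between components in all smooth charts. -/

section Manifold

variable {n : ℕ} {M : Type*} [TopologicalSpace M] [ChartedSpace (EuclideanSpace ℝ (Fin n)) M]

/-- The coordinate vector `∂_k` of the chart `e`, at the point of `M` with coordinates `x`. -/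
def coordVec (e : OpenPartialHomeomorph M (EuclideanSpace ℝ (Fin n)))
    (k : Fin n) (x : EuclideanSpace ℝ (Fin n)) : TangentSpace (𝓡 n) (e.symm x) :=
  mfderiv (𝓡 n) (𝓡 n) e.symm x (EuclideanSpace.single k (1 : ℝ))

variable [IsManifold (𝓡 n) ∞ M]

/-- The components `g_{ij} = g(∂_i, ∂_j)` of the metric in the chart `e`. -/
def metricInChart
    (g : ContMDiffRiemannianMetric (𝓡 n) ∞ (EuclideanSpace ℝ (Fin n))
      (fun p : M => TangentSpace (𝓡 n) p))
    (e : OpenPartialHomeomorph M (EuclideanSpace ℝ (Fin n)))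
    (x : EuclideanSpace ℝ (Fin n)) : Matrix (Fin n) (Fin n) ℝ :=
  Matrix.of fun i j => g.inner (e.symm x) (coordVec e i x) (coordVec e j x)

/-- The Ricci tensor of `g` does not vanish at the point `p`. -/
def RicciNeZeroAt
    (g : ContMDiffRiemannianMetric (𝓡 n) ∞ (EuclideanSpace ℝ (Fin n))
      (fun p : M => TangentSpace (𝓡 n) p)) (p : M) : Prop :=
  ∃ e ∈ IsManifold.maximalAtlas (𝓡 n) ∞ M, p ∈ e.source ∧
    ∃ i j, LocalMetric.ricci (metricInChart g e) i j (e p) ≠ 0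

/-- `β` is a smooth one-form on `M`. -/
def IsSmoothOneForm (β : (p : M) → TangentSpace (𝓡 n) p →L[ℝ] ℝ) : Prop :=
  ContMDiff (𝓡 n) ((𝓡 n).prod 𝓘(ℝ, EuclideanSpace ℝ (Fin n) →L[ℝ] ℝ)) ∞
    (fun p => TotalSpace.mk' (EuclideanSpace ℝ (Fin n) →L[ℝ] ℝ)
      (E := fun p : M => TangentSpace (𝓡 n) p →L[ℝ] ℝ) p (β p))

/-- `RR`: there is a one-form `β`, not identically zero, with `Ri_{ij;l} = β_l Ri_{ij}`. -/
def IsRicciRecurrent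
    (g : ContMDiffRiemannianMetric (𝓡 n) ∞ (EuclideanSpace ℝ (Fin n))
      (fun p : M => TangentSpace (𝓡 n) p)) : Prop :=
  ∃ β : (p : M) → TangentSpace (𝓡 n) p →L[ℝ] ℝ,
    IsSmoothOneForm β ∧ (∃ p, β p ≠ 0) ∧
    ∀ e ∈ IsManifold.maximalAtlas (𝓡 n) ∞ M, ∀ x ∈ e.target, ∀ i j l,
      LocalMetric.covDeriv (metricInChart g e) (LocalMetric.ricci (metricInChart g e)) i j l x =
        β (e.symm x) (coordVec e l x) * LocalMetric.ricci (metricInChart g e) i j x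

/-- `CO`: the Cotton tensor vanishes identically. -/
def IsCotton
    (g : ContMDiffRiemannianMetric (𝓡 n) ∞ (EuclideanSpace ℝ (Fin n))
      (fun p : M => TangentSpace (𝓡 n) p)) : Prop :=
  ∀ e ∈ IsManifold.maximalAtlas (𝓡 n) ∞ M, ∀ x ∈ e.target, ∀ i j k,
    LocalMetric.cotton (metricInChart g e) i j k x = 0

end Manifold

end

noncomputable section

namespace LocalMetric

variable {n : ℕ}

open Matrix Filter Topology

/-! ### Calculus of matrix-valued functions -/

/-! Work at a point where `β ≠ 0`. Contracting the recurrence gives `∂_l sc = β_l sc`, so the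
Schouten tensor is recurrent with the same `β`, and `C = 0` reads `β_k S_ij = β_j S_ik`. By symmetry
`S = κ β ⊗ β`, that is `Ri = s g + κ β ⊗ β` with `s = sc/(2n-2)`, and the trace gives `κ|β|² =
(n-2)s`.

If `s ≠ 0`, then `Ri/sc` is parallel near the point, so the curvature operators annihilate `Ri` as
well as `g`, hence `β ⊗ β`, hence the vector dual to `β`. Contracting, `Ri` kills that vector; but
it sends it to `(s + κ|β|²) β = (n-1)s β ≠ 0`. So `s = 0`, then `κ|β|² = 0`, and positive
definiteness forces `κ = 0`: `Ri` vanishes at the point (`IsMetricOn.ricci_eq_zero`).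

The recurrence is a linear ODE for `Ri` along curves, so a zero of `Ri` spreads to a neighbourhood
(`IsMetricOn.ricci_eq_zero_of_segment`). The zero set of `Ri` is therefore clopen, and it contains
the whole component of any point with `β ≠ 0`, against the hypothesis. Independence of the chart
rests on `IsMetricOn.ricci_eq_zero_of_comp`. -/

lemma pderiv_const (k : Fin n) (c : ℝ) (x : EuclideanSpace ℝ (Fin n)) :
    pderiv k (fun _ => c) x = 0 := by
  simp [pderiv]

lemma pderiv_add (k : Fin n) {f h : EuclideanSpace ℝ (Fin n) → ℝ} {x : EuclideanSpace ℝ (Fin n)}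
    (hf : DifferentiableAt ℝ f x) (hh : DifferentiableAt ℝ h x) :
    pderiv k (fun y => f y + h y) x = pderiv k f x + pderiv k h x := by
  simp [pderiv, fderiv_fun_add hf hh]

lemma pderiv_mul (k : Fin n) {f h : EuclideanSpace ℝ (Fin n) → ℝ} {x : EuclideanSpace ℝ (Fin n)}
    (hf : DifferentiableAt ℝ f x) (hh : DifferentiableAt ℝ h x) :
    pderiv k (fun y => f y * h y) x = pderiv k f x * h x + f x * pderiv k h x := by
  simp [pderiv, fderiv_fun_mul hf hh]; ring

lemma pderiv_sum (k : Fin n) {ι : Type*} (s : Finset ι)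
    {f : ι → EuclideanSpace ℝ (Fin n) → ℝ} {x : EuclideanSpace ℝ (Fin n)}
    (hf : ∀ i ∈ s, DifferentiableAt ℝ (f i) x) :
    pderiv k (fun y => ∑ i ∈ s, f i y) x = ∑ i ∈ s, pderiv k (f i) x := by
  simp [pderiv, fderiv_fun_sum hf]

lemma pderiv_congr (k : Fin n) {f h : EuclideanSpace ℝ (Fin n) → ℝ}
    {x : EuclideanSpace ℝ (Fin n)} (hfh : f =ᶠ[𝓝 x] h) : pderiv k f x = pderiv k h x := by
  simp [pderiv, hfh.fderiv_eq]

lemma contDiffAt_pderiv (k : Fin n) {f : EuclideanSpace ℝ (Fin n) → ℝ}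
    {x : EuclideanSpace ℝ (Fin n)} (hf : ContDiffAt ℝ ∞ f x) :
    ContDiffAt ℝ ∞ (pderiv k f) x := by
  have h : ContDiffAt ℝ ∞ (fderiv ℝ f) x := hf.fderiv_right (by simp)
  exact h.clm_apply contDiffAt_const

lemma pderiv_comm (k l : Fin n) {f : EuclideanSpace ℝ (Fin n) → ℝ}
    {x : EuclideanSpace ℝ (Fin n)} (hf : ContDiffAt ℝ ∞ f x) :
    pderiv k (pderiv l f) x = pderiv l (pderiv k f) x := by
  have h : ContDiffAt ℝ ∞ (fderiv ℝ f) x := hf.fderiv_right (by simp)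
  have hd : DifferentiableAt ℝ (fderiv ℝ f) x := h.differentiableAt (by simp)
  have hs : IsSymmSndFDerivAt ℝ f x := hf.isSymmSndFDerivAt (by
    simp only [minSmoothness_of_isRCLikeNormedField]; exact WithTop.coe_le_coe.2 le_top)
  have key (a b : Fin n) : pderiv a (pderiv b f) x
      = fderiv ℝ (fderiv ℝ f) x (EuclideanSpace.single a 1) (EuclideanSpace.single b 1) := by
    change fderiv ℝ (fun y => fderiv ℝ f y (EuclideanSpace.single b 1)) x _ = _
    rw [fderiv_clm_apply hd (differentiableAt_const _)]
    simp
  rw [key, key, hs.eq]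

lemma fderiv_apply_eq_sum_pderiv (f : EuclideanSpace ℝ (Fin n) → ℝ)
    (x v : EuclideanSpace ℝ (Fin n)) : fderiv ℝ f x v = ∑ k, v k * pderiv k f x := by
  have hv : v = ∑ k, v k • EuclideanSpace.single k (1 : ℝ) := by
    ext i
    simp [Finset.sum_apply, Pi.single_apply]
  conv_lhs => rw [hv]
  simp [pderiv]

/-- The entrywise partial derivative of a matrix-valued function. -/
def matDeriv {a b : Type*} (k : Fin n) (F : EuclideanSpace ℝ (Fin n) → Matrix a b ℝ)
    (x : EuclideanSpace ℝ (Fin n)) : Matrix a b ℝ :=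
  Matrix.of fun i j => pderiv k (fun y => F y i j) x

/-- Smoothness at a point of a matrix-valued function, entry by entry. -/
def SmoothMatAt {a b : Type*} (F : EuclideanSpace ℝ (Fin n) → Matrix a b ℝ)
    (x : EuclideanSpace ℝ (Fin n)) : Prop :=
  ∀ i j, ContDiffAt ℝ ∞ (fun y => F y i j) x

section MatDeriv

variable {a b c : Type*} {x : EuclideanSpace ℝ (Fin n)}
  {F H : EuclideanSpace ℝ (Fin n) → Matrix a b ℝ}

lemma SmoothMatAt.differentiableAt (hF : SmoothMatAt F x) (i : a) (j : b) :
    DifferentiableAt ℝ (fun y => F y i j) x :=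
  (hF i j).differentiableAt (by simp)

lemma SmoothMatAt.add (hF : SmoothMatAt F x) (hH : SmoothMatAt H x) :
    SmoothMatAt (fun y => F y + H y) x := fun i j => (hF i j).add (hH i j)

lemma SmoothMatAt.transpose (hF : SmoothMatAt F x) : SmoothMatAt (fun y => (F y)ᵀ) x :=
  fun i j => hF j i

lemma SmoothMatAt.mul [Fintype b] {K : EuclideanSpace ℝ (Fin n) → Matrix b c ℝ}
    (hF : SmoothMatAt F x) (hK : SmoothMatAt K x) : SmoothMatAt (fun y => F y * K y) x := by
  intro i j
  simp only [Matrix.mul_apply]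
  exact ContDiffAt.sum fun s _ => (hF i s).mul (hK s j)

lemma SmoothMatAt.smul {f : EuclideanSpace ℝ (Fin n) → ℝ} (hf : ContDiffAt ℝ ∞ f x)
    (hF : SmoothMatAt F x) : SmoothMatAt (fun y => f y • F y) x :=
  fun i j => hf.mul (hF i j)

lemma SmoothMatAt.sum {ι : Type*} {s : Finset ι}
    {F : ι → EuclideanSpace ℝ (Fin n) → Matrix a b ℝ}
    (hF : ∀ i ∈ s, SmoothMatAt (F i) x) : SmoothMatAt (fun y => ∑ i ∈ s, F i y) x := by
  intro i j
  simp only [Matrix.sum_apply]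
  exact ContDiffAt.sum fun k hk => hF k hk i j

lemma SmoothMatAt.matDeriv (k : Fin n) (hF : SmoothMatAt F x) : SmoothMatAt (matDeriv k F) x :=
  fun i j => contDiffAt_pderiv k (hF i j)

lemma matDeriv_congr (k : Fin n) (hFH : F =ᶠ[𝓝 x] H) : matDeriv k F x = matDeriv k H x := by
  ext i j
  exact pderiv_congr k (hFH.mono fun y hy => by simp [hy])

lemma matDeriv_add (k : Fin n) (hF : SmoothMatAt F x) (hH : SmoothMatAt H x) :
    matDeriv k (fun y => F y + H y) x = matDeriv k F x + matDeriv k H x := by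
  ext i j
  exact pderiv_add k (hF.differentiableAt i j) (hH.differentiableAt i j)

lemma matDeriv_transpose (k : Fin n) : matDeriv k (fun y => (F y)ᵀ) x = (matDeriv k F x)ᵀ := rfl

lemma matDeriv_mul [Fintype b] (k : Fin n) {K : EuclideanSpace ℝ (Fin n) → Matrix b c ℝ}
    (hF : SmoothMatAt F x) (hK : SmoothMatAt K x) :
    matDeriv k (fun y => F y * K y) x = matDeriv k F x * K x + F x * matDeriv k K x := by
  ext i j
  simp only [matDeriv, Matrix.mul_apply, Matrix.of_apply, Matrix.add_apply]
  rw [pderiv_sum k (f := fun s y => F y i s * K y s j) _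
      fun s _ => (hF.differentiableAt i s).mul (hK.differentiableAt s j),
    ← Finset.sum_add_distrib]
  exact Finset.sum_congr rfl fun s _ =>
    pderiv_mul k (hF.differentiableAt i s) (hK.differentiableAt s j)

lemma matDeriv_smul (k : Fin n) {f : EuclideanSpace ℝ (Fin n) → ℝ} (hf : ContDiffAt ℝ ∞ f x)
    (hF : SmoothMatAt F x) :
    matDeriv k (fun y => f y • F y) x = pderiv k f x • F x + f x • matDeriv k F x := by
  ext i j
  exact pderiv_mul k (hf.differentiableAt (by simp)) (hF.differentiableAt i j)

lemma matDeriv_sum {ι : Type*} (k : Fin n) {s : Finset ι}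
    {F : ι → EuclideanSpace ℝ (Fin n) → Matrix a b ℝ} (hF : ∀ i ∈ s, SmoothMatAt (F i) x) :
    matDeriv k (fun y => ∑ i ∈ s, F i y) x = ∑ i ∈ s, matDeriv k (F i) x := by
  ext i j
  simp only [matDeriv, Matrix.sum_apply, Matrix.of_apply]
  exact pderiv_sum k _ fun m hm => (hF m hm).differentiableAt i j

lemma matDeriv_comm (k l : Fin n) (hF : SmoothMatAt F x) :
    matDeriv k (matDeriv l F) x = matDeriv l (matDeriv k F) x := by
  ext i j
  exact pderiv_comm k l (hF i j)

lemma pderiv_trace [Fintype a] (k : Fin n) {F : EuclideanSpace ℝ (Fin n) → Matrix a a ℝ}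
    (hF : SmoothMatAt F x) : pderiv k (fun y => (F y).trace) x = (matDeriv k F x).trace := by
  simp only [Matrix.trace, Matrix.diag_apply, matDeriv, Matrix.of_apply]
  exact pderiv_sum k _ fun i _ => hF.differentiableAt i i

variable [Fintype a] [DecidableEq a] {F : EuclideanSpace ℝ (Fin n) → Matrix a a ℝ}

lemma SmoothMatAt.det (hF : SmoothMatAt F x) : ContDiffAt ℝ ∞ (fun y => (F y).det) x := by
  simp only [Matrix.det_apply]
  refine ContDiffAt.sum fun σ _ => ?_
  have : ContDiffAt ℝ ∞ (fun y => ∏ i, F y (σ i) i) x :=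
    contDiffAt_prod fun i _ => hF (σ i) i
  exact this.const_smul (σ.sign : ℤˣ)

lemma SmoothMatAt.inv (hF : SmoothMatAt F x) (h0 : (F x).det ≠ 0) :
    SmoothMatAt (fun y => (F y)⁻¹) x := by
  intro i j
  simp only [Matrix.inv_def, Matrix.smul_apply, Matrix.adjugate_apply, Ring.inverse_eq_inv',
    smul_eq_mul]
  refine (hF.det.inv h0).mul (SmoothMatAt.det (F := fun y => (F y).updateRow j (Pi.single i 1)) ?_)
  intro k l
  by_cases hk : k = j
  · subst hk
    simpa using contDiffAt_const
  · simpa [Matrix.updateRow_ne hk] using hF k l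

/-- Differentiate `F F⁻¹ = 1`, valid near the point because the determinant stays nonzero. -/
lemma matDeriv_inv (k : Fin n) (hF : SmoothMatAt F x) (h0 : (F x).det ≠ 0) :
    matDeriv k (fun y => (F y)⁻¹) x = -((F x)⁻¹ * matDeriv k F x * (F x)⁻¹) := by
  have hI := hF.inv h0
  have hev : ∀ᶠ y in 𝓝 x, (F y).det ≠ 0 := hF.det.continuousAt.eventually_ne h0
  have h1 : matDeriv k (fun y => F y * (F y)⁻¹) x = 0 := by
    rw [matDeriv_congr k (H := fun _ => 1)
      (hev.mono fun y hy => Matrix.mul_nonsing_inv _ (isUnit_iff_ne_zero.2 hy))]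
    ext i j
    exact pderiv_const k _ x
  rw [matDeriv_mul k hF hI] at h1
  have h2 : F x * matDeriv k (fun y => (F y)⁻¹) x = -(matDeriv k F x * (F x)⁻¹) :=
    eq_neg_of_add_eq_zero_right h1
  have h3 := congrArg (fun A => (F x)⁻¹ * A) h2
  simpa [← Matrix.mul_assoc, Matrix.nonsing_inv_mul _ (isUnit_iff_ne_zero.2 h0)] using h3

end MatDeriv

end LocalMetric

namespace LocalMetric

variable {n : ℕ}

open Matrix Filter Topology

/-! ### The Levi-Civita connection and its curvature -/

/-- `G` is a smooth Riemannian metric on the open set `U`. -/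
structure IsMetricOn (G : EuclideanSpace ℝ (Fin n) → Matrix (Fin n) (Fin n) ℝ)
    (U : Set (EuclideanSpace ℝ (Fin n))) : Prop where
  isOpen : IsOpen U
  smooth : ∀ x ∈ U, SmoothMatAt G x
  symm : ∀ x ∈ U, (G x)ᵀ = G x
  posDef : ∀ x ∈ U, (G x).PosDef

/-- The connection matrix `(Γ_i)^k_j = Γ^k_{ij}`. -/
def connMatrix (G : EuclideanSpace ℝ (Fin n) → Matrix (Fin n) (Fin n) ℝ) (i : Fin n)
    (x : EuclideanSpace ℝ (Fin n)) : Matrix (Fin n) (Fin n) ℝ :=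
  Matrix.of fun k j => christoffel G k i j x

/-- The curvature of the connection `∂_i + Γ_i`. -/
def connCurv (Γ : Fin n → EuclideanSpace ℝ (Fin n) → Matrix (Fin n) (Fin n) ℝ) (i j : Fin n)
    (x : EuclideanSpace ℝ (Fin n)) : Matrix (Fin n) (Fin n) ℝ :=
  matDeriv i (Γ j) x - matDeriv j (Γ i) x + (Γ i x * Γ j x - Γ j x * Γ i x)

variable {G : EuclideanSpace ℝ (Fin n) → Matrix (Fin n) (Fin n) ℝ}
  {U : Set (EuclideanSpace ℝ (Fin n))} {x : EuclideanSpace ℝ (Fin n)}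

lemma curvature_eq_connCurv (l i j k : Fin n) :
    curvature G l i j k x = connCurv (connMatrix G) i j x l k := by
  simp [curvature, connCurv, matDeriv, connMatrix, Matrix.mul_apply, Finset.sum_sub_distrib]

lemma ricci_eq_sum_connCurv (j k : Fin n) :
    ricci G j k x = ∑ i, connCurv (connMatrix G) i j x i k := by
  simp [ricci, curvature_eq_connCurv]

/-- Puts the covariant derivative in matrix form, so that later identities become noncommutative
matrix algebra. -/
lemma covDeriv_eq (T : EuclideanSpace ℝ (Fin n) → Matrix (Fin n) (Fin n) ℝ) (i j l : Fin n) :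
    covDeriv G (fun i j y => T y i j) i j l x
      = (matDeriv l T x - ((connMatrix G l x)ᵀ * T x + T x * connMatrix G l x)) i j := by
  simp only [covDeriv, matDeriv, connMatrix, Matrix.sub_apply, Matrix.add_apply,
    Matrix.mul_apply, Matrix.transpose_apply, Matrix.of_apply, Finset.sum_add_distrib]
  simp [mul_comm]

lemma IsMetricOn.det_ne_zero (hG : IsMetricOn G U) (hx : x ∈ U) : (G x).det ≠ 0 :=
  (hG.posDef x hx).det_pos.ne'

lemma IsMetricOn.mul_inv (hG : IsMetricOn G U) (hx : x ∈ U) : G x * (G x)⁻¹ = 1 :=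
  Matrix.mul_nonsing_inv _ (isUnit_iff_ne_zero.2 (hG.det_ne_zero hx))

lemma IsMetricOn.inv_mul (hG : IsMetricOn G U) (hx : x ∈ U) : (G x)⁻¹ * G x = 1 :=
  Matrix.nonsing_inv_mul _ (isUnit_iff_ne_zero.2 (hG.det_ne_zero hx))

lemma IsMetricOn.smooth_inv (hG : IsMetricOn G U) (hx : x ∈ U) :
    SmoothMatAt (fun y => (G y)⁻¹) x :=
  (hG.smooth x hx).inv (hG.det_ne_zero hx)

lemma IsMetricOn.eventually_mem (hG : IsMetricOn G U) (hx : x ∈ U) : ∀ᶠ y in 𝓝 x, y ∈ U :=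
  hG.isOpen.mem_nhds hx

lemma IsMetricOn.pderiv_symm (hG : IsMetricOn G U) (hx : x ∈ U) (l i j : Fin n) :
    pderiv l (fun y => G y i j) x = pderiv l (fun y => G y j i) x :=
  pderiv_congr l <| (hG.eventually_mem hx).mono fun y hy =>
    congrFun (congrFun (hG.symm y hy) j) i

lemma IsMetricOn.christoffel_comm (hG : IsMetricOn G U) (hx : x ∈ U) (k i j : Fin n) :
    christoffel G k i j x = christoffel G k j i x := by
  simp only [christoffel]
  congr 1
  refine Finset.sum_congr rfl fun l _ => ?_
  rw [hG.pderiv_symm hx l i j]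
  ring

lemma IsMetricOn.smooth_christoffel (hG : IsMetricOn G U) (hx : x ∈ U) (k i j : Fin n) :
    ContDiffAt ℝ ∞ (christoffel G k i j) x := by
  have h (l a b : Fin n) : ContDiffAt ℝ ∞ (pderiv l (fun y => G y a b)) x :=
    contDiffAt_pderiv l (hG.smooth x hx a b)
  exact contDiffAt_const.mul (ContDiffAt.sum fun l _ =>
    (hG.smooth_inv hx k l).mul (((h i j l).add (h j i l)).sub (h l i j)))

lemma IsMetricOn.smooth_connMatrix (hG : IsMetricOn G U) (hx : x ∈ U) (i : Fin n) :
    SmoothMatAt (connMatrix G i) x := fun k j => hG.smooth_christoffel hx k i j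

/-- Christoffel symbols of the first kind. -/
lemma IsMetricOn.mul_connMatrix (hG : IsMetricOn G U) (hx : x ∈ U) (i m j : Fin n) :
    (G x * connMatrix G i x) m j = (1 / 2) * (pderiv i (fun y => G y j m) x
      + pderiv j (fun y => G y i m) x - pderiv m (fun y => G y i j) x) := by
  have h : connMatrix G i x = (G x)⁻¹ * Matrix.of fun l j => (1 / 2) *
      (pderiv i (fun y => G y j l) x + pderiv j (fun y => G y i l) x
        - pderiv l (fun y => G y i j) x) := by
    ext k j
    simp only [connMatrix, christoffel, Matrix.of_apply, Matrix.mul_apply, Finset.mul_sum]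
    exact Finset.sum_congr rfl fun l _ => by ring
  rw [h, ← Matrix.mul_assoc, hG.mul_inv hx, Matrix.one_mul, Matrix.of_apply]

/-- This is `∇g = 0`: symmetrizing the Christoffel symbols of the first kind leaves only the
derivative of the metric. -/
lemma IsMetricOn.matDeriv_eq (hG : IsMetricOn G U) (hx : x ∈ U) (l : Fin n) :
    matDeriv l G x = (connMatrix G l x)ᵀ * G x + G x * connMatrix G l x := by
  have h : (connMatrix G l x)ᵀ * G x = (G x * connMatrix G l x)ᵀ := by
    rw [Matrix.transpose_mul, hG.symm x hx]
  ext i j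
  rw [h, Matrix.add_apply, Matrix.transpose_apply, hG.mul_connMatrix hx, hG.mul_connMatrix hx]
  simp only [matDeriv, Matrix.of_apply]
  rw [hG.pderiv_symm hx l j i]
  ring

/-- The Levi-Civita connection is the only symmetric connection compatible with the metric. -/
lemma IsMetricOn.connMatrix_unique (hG : IsMetricOn G U) (hx : x ∈ U)
    (Λ : Fin n → Matrix (Fin n) (Fin n) ℝ) (hs : ∀ i j k, Λ i k j = Λ j k i)
    (hΛ : ∀ l, matDeriv l G x = (Λ l)ᵀ * G x + G x * Λ l) (i : Fin n) :
    connMatrix G i x = Λ i := by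
  have hd (l a b : Fin n) : pderiv l (fun y => G y a b) x
      = (G x * Λ l) b a + (G x * Λ l) a b := by
    have h : (Λ l)ᵀ * G x = (G x * Λ l)ᵀ := by rw [Matrix.transpose_mul, hG.symm x hx]
    have := congrFun (congrFun (hΛ l) a) b
    rwa [h, Matrix.add_apply, Matrix.transpose_apply] at this
  have hL (a b c : Fin n) : (G x * Λ a) b c = (G x * Λ c) b a := by
    simp only [Matrix.mul_apply]
    exact Finset.sum_congr rfl fun k _ => by rw [hs]
  have key : G x * connMatrix G i x = G x * Λ i := by
    ext m j
    rw [hG.mul_connMatrix hx, hd, hd, hd, hL j m i, hL i j m, hL j i m]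
    ring
  simpa [← Matrix.mul_assoc, hG.inv_mul hx] using congrArg (fun A => (G x)⁻¹ * A) key

/-- The curvature annihilates parallel 2-tensors. -/
lemma connCurv_mul_eq_zero {Γ : Fin n → EuclideanSpace ℝ (Fin n) → Matrix (Fin n) (Fin n) ℝ}
    {T : EuclideanSpace ℝ (Fin n) → Matrix (Fin n) (Fin n) ℝ} (hΓ : ∀ i, SmoothMatAt (Γ i) x)
    (hT : SmoothMatAt T x)
    (h : ∀ᶠ y in 𝓝 x, ∀ l, matDeriv l T y = (Γ l y)ᵀ * T y + T y * Γ l y) (i j : Fin n) :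
    (connCurv Γ i j x)ᵀ * T x + T x * connCurv Γ i j x = 0 := by
  have h2 (a b : Fin n) : matDeriv a (matDeriv b T) x
      = (matDeriv a (Γ b) x)ᵀ * T x
        + (Γ b x)ᵀ * ((Γ a x)ᵀ * T x + T x * Γ a x)
        -- Each first derivative of `T` has been replaced through the parallel equation; equality of
        -- mixed partials then yields the curvature identity.
        + (((Γ a x)ᵀ * T x + T x * Γ a x) * Γ b x + T x * matDeriv a (Γ b) x) := by
    rw [matDeriv_congr a (h.mono fun y hy => hy b),
      matDeriv_add a ((hΓ b).transpose.mul hT) (hT.mul (hΓ b)),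
      matDeriv_mul a (hΓ b).transpose hT, matDeriv_mul a hT (hΓ b), h.self_of_nhds a,
      matDeriv_transpose]
  have h3 := matDeriv_comm i j hT
  rw [h2, h2, ← sub_eq_zero] at h3
  rw [← h3, connCurv]
  simp only [Matrix.transpose_add, Matrix.transpose_sub, Matrix.transpose_mul]
  noncomm_ring

lemma IsMetricOn.connCurv_skew (hG : IsMetricOn G U) (hx : x ∈ U) (i j : Fin n) :
    (connCurv (connMatrix G) i j x)ᵀ * G x + G x * connCurv (connMatrix G) i j x = 0 :=
  connCurv_mul_eq_zero (hG.smooth_connMatrix hx) (hG.smooth x hx)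
    ((hG.eventually_mem hx).mono fun _ hy => hG.matDeriv_eq hy) i j

/-- Skewness with respect to `G` makes `G⁻¹ Rᵀ G` equal to `-R`, while its trace is that of `R`. -/
lemma IsMetricOn.trace_connCurv (hG : IsMetricOn G U) (hx : x ∈ U) (i j : Fin n) :
    (connCurv (connMatrix G) i j x).trace = 0 := by
  have h := congrArg (fun A => ((G x)⁻¹ * A).trace) (hG.connCurv_skew hx i j)
  simp only [Matrix.mul_add, Matrix.trace_add, ← Matrix.mul_assoc, hG.inv_mul hx,
    Matrix.one_mul, Matrix.mul_zero, Matrix.trace_zero] at h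
  rw [Matrix.mul_assoc, Matrix.trace_mul_comm, Matrix.mul_assoc, hG.mul_inv hx, Matrix.mul_one,
    Matrix.trace_transpose] at h
  linarith

/-- The first Bianchi identity. -/
lemma IsMetricOn.bianchi (hG : IsMetricOn G U) (hx : x ∈ U) (l i j k : Fin n) :
    curvature G l i j k x + curvature G l j k i x + curvature G l k i j x = 0 := by
  have hp (a b c : Fin n) : pderiv a (christoffel G l b c) x = pderiv a (christoffel G l c b) x :=
    pderiv_congr a ((hG.eventually_mem hx).mono fun y hy => hG.christoffel_comm hy l b c)
  simp only [curvature, Finset.sum_sub_distrib]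
  rw [hp i j k, hp j i k, hp k j i]
  simp only [hG.christoffel_comm hx _ j k, hG.christoffel_comm hx _ i k,
    hG.christoffel_comm hx _ j i]
  ring

lemma curvature_antisymm (l i j k : Fin n) :
    curvature G l i j k x = - curvature G l j i k x := by
  simp only [curvature, Finset.sum_sub_distrib]
  ring

/-- Contract the first Bianchi identity: the middle term is the trace of a curvature operator, which
is zero. -/
lemma IsMetricOn.ricci_comm (hG : IsMetricOn G U) (hx : x ∈ U) (j k : Fin n) :
    ricci G j k x = ricci G k j x := by
  have ht : ∑ i, curvature G i j k i x = 0 := by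
    simpa [Matrix.trace, curvature_eq_connCurv] using hG.trace_connCurv hx j k
  have hb : ∑ i, (curvature G i i j k x + curvature G i j k i x + curvature G i k i j x) = 0 :=
    Finset.sum_eq_zero fun i _ => hG.bianchi hx i i j k
  have ha : ∑ i, curvature G i k i j x = - ricci G k j x := by
    rw [ricci, ← Finset.sum_neg_distrib]
    exact Finset.sum_congr rfl fun i _ => curvature_antisymm i k i j
  rw [Finset.sum_add_distrib, Finset.sum_add_distrib, ht, ha] at hb
  rw [ricci]
  linarith

/-- The Ricci tensor as a matrix-valued function. -/
def ricciMatrix (G : EuclideanSpace ℝ (Fin n) → Matrix (Fin n) (Fin n) ℝ)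
    (x : EuclideanSpace ℝ (Fin n)) : Matrix (Fin n) (Fin n) ℝ :=
  Matrix.of fun i j => ricci G i j x

lemma IsMetricOn.smooth_curvature (hG : IsMetricOn G U) (hx : x ∈ U) (l i j k : Fin n) :
    ContDiffAt ℝ ∞ (curvature G l i j k) x := by
  have h := hG.smooth_christoffel hx
  exact ((contDiffAt_pderiv i (h l j k)).sub (contDiffAt_pderiv j (h l i k))).add
    (ContDiffAt.sum fun s _ => ((h l i s).mul (h s j k)).sub ((h l j s).mul (h s i k)))

lemma IsMetricOn.smooth_ricciMatrix (hG : IsMetricOn G U) (hx : x ∈ U) :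
    SmoothMatAt (ricciMatrix G) x := by
  intro j k
  change ContDiffAt ℝ ∞ (fun y => ∑ i, curvature G i i j k y) x
  exact ContDiffAt.sum fun i _ => hG.smooth_curvature hx i i j k

lemma IsMetricOn.ricciMatrix_transpose (hG : IsMetricOn G U) (hx : x ∈ U) :
    (ricciMatrix G x)ᵀ = ricciMatrix G x := by
  ext i j
  exact hG.ricci_comm hx j i

lemma IsMetricOn.scalar_eq_trace (hG : IsMetricOn G U) (hx : x ∈ U) :
    scalar G x = ((G x)⁻¹ * ricciMatrix G x).trace := by
  simp only [scalar, Matrix.trace, Matrix.diag_apply, Matrix.mul_apply]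
  refine Finset.sum_congr rfl fun j _ => Finset.sum_congr rfl fun k _ => ?_
  rw [hG.ricci_comm hx]
  rfl

lemma IsMetricOn.smooth_scalar (hG : IsMetricOn G U) (hx : x ∈ U) :
    ContDiffAt ℝ ∞ (scalar G) x :=
  ContDiffAt.sum fun i _ => ContDiffAt.sum fun j _ =>
    (hG.smooth_inv hx i j).mul (hG.smooth_ricciMatrix hx i j)

/-- The covariant derivative commutes with the metric trace. -/
lemma IsMetricOn.pderiv_trace_inv_mul (hG : IsMetricOn G U) (hx : x ∈ U)
    {T : EuclideanSpace ℝ (Fin n) → Matrix (Fin n) (Fin n) ℝ} (hT : SmoothMatAt T x)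
    (l : Fin n) :
    pderiv l (fun y => ((G y)⁻¹ * T y).trace) x = ((G x)⁻¹ *
      (matDeriv l T x - ((connMatrix G l x)ᵀ * T x + T x * connMatrix G l x))).trace := by
  rw [pderiv_trace l ((hG.smooth_inv hx).mul hT), matDeriv_mul l (hG.smooth_inv hx) hT,
    matDeriv_inv l (hG.smooth x hx) (hG.det_ne_zero hx), hG.matDeriv_eq hx]
  have h1 : (G x)⁻¹ * ((connMatrix G l x)ᵀ * G x + G x * connMatrix G l x) * (G x)⁻¹
      = (G x)⁻¹ * (connMatrix G l x)ᵀ + connMatrix G l x * (G x)⁻¹ := by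
    simp only [Matrix.mul_add, Matrix.add_mul, Matrix.mul_assoc, hG.mul_inv hx, Matrix.mul_one]
    simp only [← Matrix.mul_assoc, hG.inv_mul hx, Matrix.one_mul]
  have h2 : (connMatrix G l x * ((G x)⁻¹ * T x)).trace
      = ((G x)⁻¹ * (T x * connMatrix G l x)).trace := by
    rw [Matrix.trace_mul_comm, Matrix.mul_assoc]
  rw [h1]
  simp only [Matrix.mul_add, Matrix.mul_sub, Matrix.add_mul, Matrix.neg_mul, Matrix.trace_add,
    Matrix.trace_sub, Matrix.trace_neg, Matrix.mul_assoc, h2]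
  ring

end LocalMetric

namespace LocalMetric

variable {n : ℕ}

open Matrix Filter Topology

/-! ### Ricci recurrent metrics with vanishing Cotton tensor -/

lemma pderiv_inv (k : Fin n) {f : EuclideanSpace ℝ (Fin n) → ℝ} {x : EuclideanSpace ℝ (Fin n)}
    (hf : DifferentiableAt ℝ f x) (h0 : f x ≠ 0) :
    pderiv k (fun y => (f y)⁻¹) x = -(pderiv k f x * ((f x)⁻¹ * (f x)⁻¹)) := by
  have h := (hasDerivAt_inv h0).comp_hasFDerivAt x hf.hasFDerivAt
  have h' : fderiv ℝ (fun y => (f y)⁻¹) x = -(f x ^ 2)⁻¹ • fderiv ℝ f x := h.fderiv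
  simp only [pderiv, h', _root_.smul_apply, smul_eq_mul]
  field_simp

section Algebra

variable {A G : Matrix (Fin n) (Fin n) ℝ} {b : Fin n → ℝ} {s : ℝ}

/-- A symmetric matrix `Z` with `b_k Z_{ij} = b_j Z_{ik}` is a multiple of `b ⊗ b`. -/
lemma exists_eq_smul_vecMulVec {Z : Matrix (Fin n) (Fin n) ℝ} (hZ : Zᵀ = Z) (hb : b ≠ 0)
    (h : ∀ i j k, b k * Z i j = b j * Z i k) : ∃ κ : ℝ, Z = κ • Matrix.vecMulVec b b := by
  obtain ⟨p, hp⟩ := Function.ne_iff.1 hb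
  have hp : b p ≠ 0 := hp
  have hs (i j) : Z i j = Z j i := congrFun (congrFun hZ.symm i) j
  -- The constant is forced by the diagonal entry at an index `p` with `b p ≠ 0`.
  refine ⟨Z p p / (b p * b p), ?_⟩
  ext i j
  have h1 := h i j p
  have h2 := h p i p
  rw [hs p i] at h2
  simp only [Matrix.smul_apply, Matrix.vecMulVec_apply, smul_eq_mul]
  field_simp
  calc Z i j * b p ^ 2 = (b p * Z i j) * b p := by ring
    _ = b j * (b p * Z i p) := by rw [h1]; ring
    _ = _ := by rw [h2]; ring

lemma trace_inv_mul_vecMulVec (κ : ℝ) :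
    (G⁻¹ * (κ • Matrix.vecMulVec b b)).trace = κ * (b ⬝ᵥ G⁻¹ *ᵥ b) := by
  rw [Matrix.mul_smul, Matrix.trace_smul, Matrix.mul_vecMulVec, Matrix.trace_vecMulVec,
    dotProduct_comm, smul_eq_mul]

/-- If `a ⊗ b + b ⊗ a = 0` and `b ≠ 0` then `a = 0`. -/
lemma eq_zero_of_vecMulVec_add {a : Fin n → ℝ} (hb : b ≠ 0)
    (h : ∀ i j, a i * b j + b i * a j = 0) : a = 0 := by
  obtain ⟨p, hp⟩ := Function.ne_iff.1 hb
  have hp : b p ≠ 0 := hp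
  have hap : a p = 0 := by
    have : a p * b p = 0 := by linarith [h p p, mul_comm (a p) (b p)]
    exact (mul_eq_zero.1 this).resolve_right hp
  ext i
  have := h i p
  rw [hap, mul_zero, add_zero] at this
  exact (mul_eq_zero.1 this).resolve_right hp

/-- A matrix which is skew with respect to `G` and `G + κ' b ⊗ b` annihilates `G⁻¹ b`. -/
lemma mulVec_inv_mulVec_eq_zero {R : Matrix (Fin n) (Fin n) ℝ} (hG : G.det ≠ 0) (hb : b ≠ 0)
    {κ : ℝ} (hκ : κ ≠ 0) (hA : A = s • G + κ • Matrix.vecMulVec b b)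
    (hRG : Rᵀ * G + G * R = 0) (hRA : Rᵀ * A + A * R = 0) : R *ᵥ (G⁻¹ *ᵥ b) = 0 := by
  have hdet : IsUnit G.det := isUnit_iff_ne_zero.2 hG
  -- Skewness with respect to `G` removes the `s • G` part of `A`, leaving the rank-one part.
  have h1 : κ • (Rᵀ * Matrix.vecMulVec b b + Matrix.vecMulVec b b * R) = 0 := by
    have : s • (Rᵀ * G + G * R)
        + κ • (Rᵀ * Matrix.vecMulVec b b + Matrix.vecMulVec b b * R) = Rᵀ * A + A * R := by
      rw [hA]
      simp only [Matrix.mul_add, Matrix.add_mul, Matrix.mul_smul, Matrix.smul_mul, smul_add]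
      abel
    rwa [hRG, hRA, smul_zero, zero_add] at this
  have h2 := (smul_eq_zero.1 h1).resolve_left hκ
  have h3 : Rᵀ *ᵥ b = 0 := by
    refine eq_zero_of_vecMulVec_add hb fun i j => ?_
    have := congrFun (congrFun h2 i) j
    rw [Matrix.mul_vecMulVec, Matrix.vecMulVec_mul, ← Matrix.mulVec_transpose] at this
    simpa [Matrix.vecMulVec_apply] using this
  -- Skewness gives `G R G⁻¹ b = -Rᵀ b`, which is zero by `h3`.
  have h4 : G *ᵥ (R *ᵥ (G⁻¹ *ᵥ b)) = 0 := by
    have h5 := congrArg (fun B => B *ᵥ (G⁻¹ *ᵥ b)) hRG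
    simp only [Matrix.add_mulVec, Matrix.zero_mulVec, ← Matrix.mulVec_mulVec] at h5
    rw [Matrix.mulVec_mulVec b G, Matrix.mul_nonsing_inv _ hdet, Matrix.one_mulVec, h3,
      zero_add] at h5
    exact h5
  have h6 := congrArg (fun v => G⁻¹ *ᵥ v) h4
  simpa [Matrix.mulVec_mulVec, ← Matrix.mul_assoc, Matrix.nonsing_inv_mul _ hdet] using h6

end Algebra

variable {G : EuclideanSpace ℝ (Fin n) → Matrix (Fin n) (Fin n) ℝ}
  {U : Set (EuclideanSpace ℝ (Fin n))} {x : EuclideanSpace ℝ (Fin n)}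
  {b : Fin n → EuclideanSpace ℝ (Fin n) → ℝ}

lemma matDeriv_ricciMatrix
    (hR : ∀ i j l, covDeriv G (ricci G) i j l x = b l x * ricci G i j x) (l : Fin n) :
    matDeriv l (ricciMatrix G) x - ((connMatrix G l x)ᵀ * ricciMatrix G x
      + ricciMatrix G x * connMatrix G l x) = b l x • ricciMatrix G x := by
  ext i j
  rw [← covDeriv_eq]
  exact hR i j l

/-- The metric trace of the recurrence, since covariant differentiation commutes with that trace. -/
lemma IsMetricOn.pderiv_scalar (hG : IsMetricOn G U) (hx : x ∈ U)
    (hR : ∀ i j l, covDeriv G (ricci G) i j l x = b l x * ricci G i j x) (l : Fin n) :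
    pderiv l (scalar G) x = b l x * scalar G x := by
  rw [pderiv_congr l ((hG.eventually_mem hx).mono fun y hy => hG.scalar_eq_trace hy),
    hG.pderiv_trace_inv_mul hx (hG.smooth_ricciMatrix hx), matDeriv_ricciMatrix hR,
    hG.scalar_eq_trace hx, Matrix.mul_smul, Matrix.trace_smul, smul_eq_mul]

/-- Since `sc` and `Ri` are recurrent with the same form and `g` is parallel, the Schouten tensor is
recurrent too, so the Cotton tensor becomes algebraic in it. -/
lemma IsMetricOn.cotton_eq (hG : IsMetricOn G U) (hx : x ∈ U)
    (hR : ∀ i j l, covDeriv G (ricci G) i j l x = b l x * ricci G i j x) (i j k : Fin n) :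
    cotton G i j k x = b k x * schouten G i j x - b j x * schouten G i k x := by
  have hS : schouten G = fun i j y => (ricciMatrix G y
      + (-(2 * (n : ℝ) - 2)⁻¹ * scalar G y) • G y) i j := by
    ext i j y
    simp only [schouten, ricciMatrix, Matrix.add_apply, Matrix.of_apply, Matrix.smul_apply,
      smul_eq_mul]
    ring
  have hc : ContDiffAt ℝ ∞ (fun y => -(2 * (n : ℝ) - 2)⁻¹ * scalar G y) x :=
    contDiffAt_const.mul (hG.smooth_scalar hx)
  have hcov (i j l : Fin n) : covDeriv G (schouten G) i j l x = b l x * schouten G i j x := by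
    have h1 := matDeriv_ricciMatrix hR l
    have h2 : pderiv l (fun y => -(2 * (n : ℝ) - 2)⁻¹ * scalar G y) x
        = b l x * (-(2 * (n : ℝ) - 2)⁻¹ * scalar G x) := by
      rw [pderiv_mul l (differentiableAt_const _)
        ((hG.smooth_scalar hx).differentiableAt (by simp)), pderiv_const,
        hG.pderiv_scalar hx hR]
      ring
    rw [hS, covDeriv_eq, matDeriv_add l (hG.smooth_ricciMatrix hx) ((hG.smooth x hx).smul hc),
      matDeriv_smul l hc (hG.smooth x hx), h2, eq_add_of_sub_eq h1, hG.matDeriv_eq hx]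
    change _ = (b l x • (ricciMatrix G x + (-(2 * (n : ℝ) - 2)⁻¹ * scalar G x) • G x)) i j
    refine congrFun (congrFun ?_ i) j
    simp only [Matrix.mul_add, Matrix.add_mul, Matrix.mul_smul, Matrix.smul_mul, smul_add,
      smul_smul]
    abel
  rw [cotton, hcov, hcov]

/-- Where `sc ≠ 0`, the tensor `Ri/sc` is parallel, because the recurrence forms of `Ri` and `sc`
cancel in the quotient. -/
lemma IsMetricOn.connCurv_mul_ricciMatrix (hG : IsMetricOn G U) (hx : x ∈ U)
    (hR : ∀ y ∈ U, ∀ i j l, covDeriv G (ricci G) i j l y = b l y * ricci G i j y)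
    (h0 : scalar G x ≠ 0) (i j : Fin n) :
    (connCurv (connMatrix G) i j x)ᵀ * ricciMatrix G x
      + ricciMatrix G x * connCurv (connMatrix G) i j x = 0 := by
  have hev : ∀ᶠ y in 𝓝 x, scalar G y ≠ 0 :=
    (hG.smooth_scalar hx).continuousAt.eventually_ne h0
  have h := connCurv_mul_eq_zero (T := fun y => (scalar G y)⁻¹ • ricciMatrix G y)
    (hG.smooth_connMatrix hx) ((hG.smooth_ricciMatrix hx).smul ((hG.smooth_scalar hx).inv h0))
    (by
      filter_upwards [hev, hG.eventually_mem hx] with y hy hyU l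
      have hs := hG.smooth_scalar hyU
      have hinv : ContDiffAt ℝ ∞ (fun z => (scalar G z)⁻¹) y := hs.inv hy
      rw [matDeriv_smul l hinv (hG.smooth_ricciMatrix hyU),
        pderiv_inv l (hs.differentiableAt (by simp)) hy, hG.pderiv_scalar hyU (hR y hyU),
        eq_add_of_sub_eq (matDeriv_ricciMatrix (hR y hyU) l)]
      have hc : -(b l y * scalar G y * ((scalar G y)⁻¹ * (scalar G y)⁻¹))
          = -((scalar G y)⁻¹ * b l y) := by
        field_simp
      rw [hc]
      simp only [Matrix.mul_smul, Matrix.smul_mul, smul_add, smul_smul, neg_smul]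
      abel) i j
  simp only [Matrix.mul_smul, Matrix.smul_mul, ← smul_add] at h
  exact (smul_eq_zero.1 h).resolve_left (inv_ne_zero h0)

/-- If a metric is Ricci recurrent with vanishing Cotton tensor, then its Ricci tensor vanishes
wherever the recurrence form does not. -/
theorem IsMetricOn.ricci_eq_zero (hn : 3 ≤ n) (hG : IsMetricOn G U) (hx : x ∈ U)
    (hR : ∀ y ∈ U, ∀ i j l, covDeriv G (ricci G) i j l y = b l y * ricci G i j y)
    (hC : ∀ i j k, cotton G i j k x = 0) {p : Fin n} (hb : b p x ≠ 0) (i j : Fin n) :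
    ricci G i j x = 0 := by
  have hn' : (3 : ℝ) ≤ n := by exact_mod_cast hn
  set β : Fin n → ℝ := fun i => b i x
  have hβ : β ≠ 0 := fun h => hb (congrFun h p)
  set s : ℝ := scalar G x / (2 * (n : ℝ) - 2)
  have hs : scalar G x = (2 * (n : ℝ) - 2) * s := by
    have : 2 * (n : ℝ) - 2 ≠ 0 := by linarith
    simp only [s]
    rw [mul_comm, div_mul_cancel₀ _ this]
  have hdet := hG.det_ne_zero hx
  obtain ⟨κ, hκ⟩ := exists_eq_smul_vecMulVec (b := β) (Z := ricciMatrix G x - s • G x)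
    (by rw [Matrix.transpose_sub, Matrix.transpose_smul, hG.symm x hx,
      hG.ricciMatrix_transpose hx]) hβ
    (fun i j k => by
      have := hC i j k
      rw [hG.cotton_eq hx (hR x hx)] at this
      exact sub_eq_zero.1 this)
  have hA : ricciMatrix G x = s • G x + κ • Matrix.vecMulVec β β := by
    rw [← hκ]
    abel
  -- Trace of `hA`: `(2n-2)s = ns + κ|β|²`.
  have htr : κ * (β ⬝ᵥ (G x)⁻¹ *ᵥ β) = ((n : ℝ) - 2) * s := by
    have h1 := hG.scalar_eq_trace hx
    rw [hA, Matrix.mul_add, Matrix.trace_add, trace_inv_mul_vecMulVec, Matrix.mul_smul,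
      hG.inv_mul hx, Matrix.trace_smul, Matrix.trace_one, Fintype.card_fin, hs,
      smul_eq_mul] at h1
    linarith
  have hAβ : ricciMatrix G x *ᵥ ((G x)⁻¹ *ᵥ β) = (((n : ℝ) - 1) * s) • β := by
    rw [hA, Matrix.add_mulVec, Matrix.smul_mulVec, Matrix.smul_mulVec, Matrix.mulVec_mulVec,
      hG.mul_inv hx, Matrix.one_mulVec, Matrix.vecMulVec_mulVec]
    ext i
    simp only [Pi.add_apply, Pi.smul_apply, smul_eq_mul, MulOpposite.smul_eq_mul_unop,
      MulOpposite.unop_op]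
    linear_combination β i * htr
  have hs0 : s = 0 := by
    by_contra hs0
    have hsc : scalar G x ≠ 0 := by
      rw [hs]
      exact mul_ne_zero (by linarith) hs0
    -- Here `n ≥ 3` matters: `κ = 0` would give `(n-2)s = 0`.
    have hκ0 : κ ≠ 0 := by
      rintro rfl
      rw [zero_mul] at htr
      exact mul_ne_zero (by linarith) hs0 htr.symm
    have hzero : ricciMatrix G x *ᵥ ((G x)⁻¹ *ᵥ β) = 0 := by
      ext j
      -- Every curvature operator kills the dual vector of `β`; contracting the upper index with `i`
      -- turns this into the vanishing of Ricci on that vector.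
      have hi (i : Fin n) : ∑ k, connCurv (connMatrix G) i j x i k * ((G x)⁻¹ *ᵥ β) k = 0 :=
        congrFun (mulVec_inv_mulVec_eq_zero hdet hβ hκ0 hA (hG.connCurv_skew hx i j)
          (hG.connCurv_mul_ricciMatrix hx hR hsc i j)) i
      simp only [Matrix.mulVec, dotProduct, ricciMatrix, Matrix.of_apply, ricci_eq_sum_connCurv,
        Finset.sum_mul, Pi.zero_apply]
      rw [Finset.sum_comm]
      exact Finset.sum_eq_zero fun i _ => hi i
    rw [hAβ] at hzero
    exact (mul_ne_zero (by linarith) hs0) ((smul_eq_zero.1 hzero).resolve_right hβ)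
  -- The only use of definiteness beyond invertibility: `β` cannot be a null covector.
  have hpos : (β ⬝ᵥ (G x)⁻¹ *ᵥ β) ≠ 0 := by
    simpa using ((hG.posDef x hx).inv.dotProduct_mulVec_pos hβ).ne'
  have hκ0 : κ = 0 := by
    rw [hs0, mul_zero] at htr
    exact (mul_eq_zero.1 htr).resolve_right hpos
  have := congrFun (congrFun hA i) j
  simpa [hs0, hκ0, ricciMatrix] using this

end LocalMetric

/-! ### Propagation of zeros of a recurrent Ricci tensor -/

namespace LocalMetric

variable {n : ℕ}

open Matrix Filter Topology

variable {G : EuclideanSpace ℝ (Fin n) → Matrix (Fin n) (Fin n) ℝ}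
  {U : Set (EuclideanSpace ℝ (Fin n))} {x y : EuclideanSpace ℝ (Fin n)}
  {b : Fin n → EuclideanSpace ℝ (Fin n) → ℝ}

/-- If a recurrent Ricci tensor vanishes at a point, it vanishes along each segment from it. -/
theorem IsMetricOn.ricci_eq_zero_of_segment (hG : IsMetricOn G U)
    (hb : ∀ l, ContinuousOn (b l) U)
    (hR : ∀ y ∈ U, ∀ i j l, covDeriv G (ricci G) i j l y = b l y * ricci G i j y)
    (hxy : segment ℝ x y ⊆ U) (hx : ∀ i j, ricci G i j x = 0) (i j : Fin n) :
    ricci G i j y = 0 := by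
  set γ : ℝ → EuclideanSpace ℝ (Fin n) := fun t => x + t • (y - x) with hγ
  set v := y - x
  have hγU {t : ℝ} (ht : t ∈ Set.Icc (0 : ℝ) 1) : γ t ∈ U := by
    apply hxy
    rw [segment_eq_image']
    exact ⟨t, ht, rfl⟩
  have hγc : Continuous γ := by fun_prop
  have hγd (t : ℝ) : HasDerivAt γ v t := by
    have h := ((hasDerivAt_id t).smul_const v).const_add x
    rwa [one_smul] at h
  have hγm : Set.MapsTo γ (Set.Icc 0 1) U := fun t ht => hγU ht
  set f : ℝ → Fin n → Fin n → ℝ := fun t i j => ricci G i j (γ t)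
  set f' : ℝ → Fin n → Fin n → ℝ := fun t i j => ∑ l, v l * (b l (γ t) * ricci G i j (γ t)
    + ∑ s, (christoffel G s l i (γ t) * ricci G s j (γ t)
      + christoffel G s l j (γ t) * ricci G i s (γ t)))
  -- A growth rate independent of `i` and `j`: the Christoffel terms are summed over all `k`, once
  -- for each of the two tensor slots.
  set c : ℝ → ℝ := fun t => ∑ l, |v l| * (|b l (γ t)|
    + ∑ s, ∑ k, (|christoffel G s l k (γ t)| + |christoffel G s l k (γ t)|))
  have hsm {t : ℝ} (ht : t ∈ Set.Icc (0 : ℝ) 1) (i j : Fin n) :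
      ContDiffAt ℝ ∞ (ricci G i j) (γ t) := hG.smooth_ricciMatrix (hγU ht) i j
  have hd {t : ℝ} (ht : t ∈ Set.Icc (0 : ℝ) 1) : HasDerivAt f (f' t) t := by
    refine hasDerivAt_pi.2 fun i => hasDerivAt_pi.2 fun j => ?_
    have h1 : HasDerivAt (fun t => f t i j) (∑ l, v l * pderiv l (ricci G i j) (γ t)) t := by
      rw [← fderiv_apply_eq_sum_pderiv]
      exact ((hsm ht i j).differentiableAt (by simp)).hasFDerivAt.comp_hasDerivAt t (hγd t)
    have h3 : f' t i j = ∑ l, v l * pderiv l (ricci G i j) (γ t) := by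
      refine Finset.sum_congr rfl fun l _ => ?_
      have h2 := hR _ (hγU ht) i j l
      rw [covDeriv, sub_eq_iff_eq_add] at h2
      rw [h2]
    rw [h3]
    exact h1
  have hcc : ContinuousOn c (Set.Icc 0 1) := by
    have h1 (l : Fin n) : ContinuousOn (fun t => b l (γ t)) (Set.Icc 0 1) :=
      (hb l).comp hγc.continuousOn hγm
    have h2 (s l k : Fin n) : ContinuousOn (fun t => christoffel G s l k (γ t)) (Set.Icc 0 1) :=
      fun t ht => ((hG.smooth_christoffel (hγU ht) s l k).continuousAt.comp
        hγc.continuousAt).continuousWithinAt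
    fun_prop
  obtain ⟨K, hK⟩ := isCompact_Icc.bddAbove_image hcc
  have hle (t : ℝ) (i j : Fin n) : |ricci G i j (γ t)| ≤ ‖f t‖ :=
    (norm_le_pi_norm (f t i) j).trans (norm_le_pi_norm (f t) i)
  have hbound (t : ℝ) : ‖f' t‖ ≤ c t * ‖f t‖ := by
    have hc0 : 0 ≤ c t := by positivity
    have h0 : 0 ≤ c t * ‖f t‖ := by positivity
    refine (pi_norm_le_iff_of_nonneg h0).2 fun i => (pi_norm_le_iff_of_nonneg h0).2 fun j => ?_
    simp only [f', c, Real.norm_eq_abs, Finset.sum_mul]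
    refine (Finset.abs_sum_le_sum_abs _ _).trans (Finset.sum_le_sum fun l _ => ?_)
    rw [abs_mul, mul_assoc]
    refine mul_le_mul_of_nonneg_left ?_ (abs_nonneg _)
    rw [add_mul, Finset.sum_mul]
    refine (abs_add_le _ _).trans (add_le_add ?_ ?_)
    · rw [abs_mul]
      exact mul_le_mul_of_nonneg_left (hle t i j) (abs_nonneg _)
    · refine (Finset.abs_sum_le_sum_abs _ _).trans (Finset.sum_le_sum fun s _ => ?_)
      have hk (k : Fin n) : |christoffel G s l k (γ t)|
          ≤ ∑ k, |christoffel G s l k (γ t)| :=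
        Finset.single_le_sum (f := fun k => |christoffel G s l k (γ t)|)
          (fun k _ => abs_nonneg _) (Finset.mem_univ k)
      refine (abs_add_le _ _).trans ?_
      rw [Finset.sum_add_distrib, add_mul, abs_mul, abs_mul]
      exact add_le_add
        (mul_le_mul (hk i) (hle t s j) (abs_nonneg _) ((abs_nonneg _).trans (hk i)))
        (mul_le_mul (hk j) (hle t i s) (abs_nonneg _) ((abs_nonneg _).trans (hk j)))
  -- Grönwall: `f 0 = 0` and `‖f'‖ ≤ K ‖f‖` on the interval force `f = 0`, evaluated at the endpoint
  -- `1`.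
  have hf1 := eq_zero_of_abs_deriv_le_mul_abs_self_of_eq_zero_right (f := f) (f' := f') (K := K)
    (a := 0) (b := 1) (fun t ht => (hd ht).continuousAt.continuousWithinAt)
    (fun t ht => (hd (Set.Ico_subset_Icc_self ht)).hasDerivWithinAt)
    (by
      ext i j
      simpa [f, γ] using hx i j)
    (fun t ht => (hbound t).trans (mul_le_mul_of_nonneg_right
      (hK (Set.mem_image_of_mem c (Set.Ico_subset_Icc_self ht))) (norm_nonneg _)))
    1 (by simp)
  simpa [f, γ, v] using congrFun (congrFun hf1 i) j

end LocalMetric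

namespace LocalMetric

variable {n : ℕ}

open Matrix Filter Topology

/-! ### Change of coordinates -/

/-- The Jacobian matrix of `φ`. -/
def jacobian (φ : EuclideanSpace ℝ (Fin n) → EuclideanSpace ℝ (Fin n))
    (x : EuclideanSpace ℝ (Fin n)) : Matrix (Fin n) (Fin n) ℝ :=
  Matrix.of fun a i => pderiv i (fun y => φ y a) x

section

variable {φ : EuclideanSpace ℝ (Fin n) → EuclideanSpace ℝ (Fin n)}
  {x : EuclideanSpace ℝ (Fin n)}

lemma contDiffAt_coord (hφ : ContDiffAt ℝ ∞ φ x) (a : Fin n) :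
    ContDiffAt ℝ ∞ (fun y => φ y a) x :=
  contDiffAt_euclidean.1 hφ a

lemma smoothMatAt_jacobian (hφ : ContDiffAt ℝ ∞ φ x) : SmoothMatAt (jacobian φ) x :=
  fun a i => contDiffAt_pderiv i (contDiffAt_coord hφ a)

lemma fderiv_single_apply (hφ : ContDiffAt ℝ ∞ φ x) (i a : Fin n) :
    fderiv ℝ φ x (EuclideanSpace.single i 1) a = jacobian φ x a i := by
  have h := (EuclideanSpace.proj (𝕜 := ℝ) a).hasFDerivAt.comp x
    (hφ.differentiableAt (by simp)).hasFDerivAt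
  have h' : fderiv ℝ (fun y => φ y a) x = _ := h.fderiv
  simp [jacobian, pderiv, h']

lemma SmoothMatAt.comp {a b : Type*} {F : EuclideanSpace ℝ (Fin n) → Matrix a b ℝ}
    (hφ : ContDiffAt ℝ ∞ φ x) (hF : SmoothMatAt F (φ x)) : SmoothMatAt (fun y => F (φ y)) x :=
  fun i j => (hF i j).comp x hφ

lemma matDeriv_comp {a b : Type*} (i : Fin n) {F : EuclideanSpace ℝ (Fin n) → Matrix a b ℝ}
    (hφ : ContDiffAt ℝ ∞ φ x) (hF : SmoothMatAt F (φ x)) :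
    matDeriv i (fun y => F (φ y)) x = ∑ c, jacobian φ x c i • matDeriv c F (φ x) := by
  ext k l
  have h := (hF.differentiableAt k l).hasFDerivAt.comp x
    (hφ.differentiableAt (by simp)).hasFDerivAt
  have h' : fderiv ℝ (fun y => F (φ y) k l) x = _ := h.fderiv
  simp only [matDeriv, Matrix.of_apply, Matrix.sum_apply, Matrix.smul_apply, smul_eq_mul]
  rw [pderiv, h', ContinuousLinearMap.comp_apply, fderiv_apply_eq_sum_pderiv]
  exact Finset.sum_congr rfl fun c _ => by rw [fderiv_single_apply hφ]

lemma pderiv_jacobian_comm (hφ : ContDiffAt ℝ ∞ φ x) (a i j : Fin n) :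
    pderiv i (fun y => jacobian φ y a j) x = pderiv j (fun y => jacobian φ y a i) x :=
  pderiv_comm i j (contDiffAt_coord hφ a)

/-- The pull-back of connection matrices by `φ`. -/
def pullConn (φ : EuclideanSpace ℝ (Fin n) → EuclideanSpace ℝ (Fin n))
    (Γ : Fin n → EuclideanSpace ℝ (Fin n) → Matrix (Fin n) (Fin n) ℝ) (i : Fin n)
    (x : EuclideanSpace ℝ (Fin n)) : Matrix (Fin n) (Fin n) ℝ :=
  ∑ a, jacobian φ x a i • Γ a (φ x)

variable {Γ A : Fin n → EuclideanSpace ℝ (Fin n) → Matrix (Fin n) (Fin n) ℝ}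

lemma smoothMatAt_pullConn (hφ : ContDiffAt ℝ ∞ φ x) (hΓ : ∀ a, SmoothMatAt (Γ a) (φ x))
    (i : Fin n) : SmoothMatAt (pullConn φ Γ i) x :=
  SmoothMatAt.sum fun a _ =>
    ((hΓ a).comp hφ).smul (f := fun y => jacobian φ y a i) (smoothMatAt_jacobian hφ a i)

/-- Curvature pulls back as a two-form: the second derivatives of `φ` are symmetric in `i, j` and
cancel in the antisymmetrization. -/
lemma connCurv_pullConn (hφ : ContDiffAt ℝ ∞ φ x) (hΓ : ∀ a, SmoothMatAt (Γ a) (φ x))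
    (i j : Fin n) :
    connCurv (pullConn φ Γ) i j x
      = ∑ a, jacobian φ x a i • ∑ b, jacobian φ x b j • connCurv Γ a b (φ x) := by
  have h (i j : Fin n) : matDeriv i (pullConn φ Γ j) x
      = ∑ b, pderiv i (fun y => jacobian φ y b j) x • Γ b (φ x)
        + ∑ b, ∑ a, (jacobian φ x b j * jacobian φ x a i) • matDeriv a (Γ b) (φ x) := by
    change matDeriv i (fun y => ∑ b, jacobian φ y b j • Γ b (φ y)) x = _
    rw [matDeriv_sum i fun b _ =>
      ((hΓ b).comp hφ).smul (f := fun y => jacobian φ y b j) (smoothMatAt_jacobian hφ b j),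
      ← Finset.sum_add_distrib]
    refine Finset.sum_congr rfl fun b _ => ?_
    rw [matDeriv_smul i (f := fun y => jacobian φ y b j) (smoothMatAt_jacobian hφ b j)
      ((hΓ b).comp hφ), matDeriv_comp i hφ (hΓ b), Finset.smul_sum]
    simp only [smul_smul]
  have hprod (i j : Fin n) : pullConn φ Γ i x * pullConn φ Γ j x
      = ∑ a, ∑ b, (jacobian φ x a i * jacobian φ x b j) • (Γ a (φ x) * Γ b (φ x)) := by
    simp only [pullConn, Finset.sum_mul_sum, smul_mul_smul_comm]
  have hs : ∑ b, pderiv i (fun y => jacobian φ y b j) x • Γ b (φ x)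
      = ∑ b, pderiv j (fun y => jacobian φ y b i) x • Γ b (φ x) :=
    Finset.sum_congr rfl fun b _ => by rw [pderiv_jacobian_comm hφ]
  simp only [connCurv, h, hprod, hs, add_sub_add_left_eq_sub, Finset.smul_sum, smul_smul]
  rw [Finset.sum_comm, Finset.sum_comm (f := fun a b =>
    (jacobian φ x a j * jacobian φ x b i) • (Γ a (φ x) * Γ b (φ x)))]
  simp only [← Finset.sum_sub_distrib, ← Finset.sum_add_distrib]
  refine Finset.sum_congr rfl fun a _ => Finset.sum_congr rfl fun b _ => ?_
  rw [mul_comm (jacobian φ x b j)]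
  simp only [smul_add, smul_sub]

/-- Behaviour of the curvature under a change of frame. -/
lemma mul_connCurv_of_gauge {J : EuclideanSpace ℝ (Fin n) → Matrix (Fin n) (Fin n) ℝ}
    (hΓ : ∀ i, SmoothMatAt (Γ i) x) (hA : ∀ i, SmoothMatAt (A i) x) (hJ : SmoothMatAt J x)
    (h : ∀ᶠ y in 𝓝 x, ∀ i, J y * Γ i y = A i y * J y + matDeriv i J y) (i j : Fin n) :
    J x * connCurv Γ i j x = connCurv A i j x * J x := by
  have hd (m i : Fin n) : matDeriv m J x * Γ i x + J x * matDeriv m (Γ i) x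
      = matDeriv m (A i) x * J x + A i x * matDeriv m J x + matDeriv m (matDeriv i J) x := by
    rw [← matDeriv_mul m hJ (hΓ i), matDeriv_congr m (h.mono fun y hy => hy i),
      matDeriv_add m ((hA i).mul hJ) (hJ.matDeriv i), matDeriv_mul m (hA i) hJ]
  have h0 (m : Fin n) : matDeriv m J x = J x * Γ m x - A m x * J x := by
    rw [h.self_of_nhds m]
    abel
  have h1 := hd i j
  have h2 := hd j i
  rw [matDeriv_comm j i hJ] at h2
  have h3 : J x * matDeriv i (Γ j) x - J x * matDeriv j (Γ i) x
      = matDeriv i (A j) x * J x + A j x * matDeriv i J x - matDeriv i J x * Γ j x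
        - (matDeriv j (A i) x * J x + A i x * matDeriv j J x - matDeriv j J x * Γ i x) := by
    rw [eq_sub_of_add_eq' h1, eq_sub_of_add_eq' h2]
    abel
  -- Eliminating the derivatives of `J` leaves a pure matrix identity.
  rw [h0, h0] at h3
  rw [connCurv, connCurv, Matrix.mul_add, Matrix.mul_sub, h3]
  noncomm_ring

end

variable {G G' : EuclideanSpace ℝ (Fin n) → Matrix (Fin n) (Fin n) ℝ}
  {U U' : Set (EuclideanSpace ℝ (Fin n))} {x : EuclideanSpace ℝ (Fin n)}
  {φ : EuclideanSpace ℝ (Fin n) → EuclideanSpace ℝ (Fin n)}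

lemma IsMetricOn.isUnit_det_jacobian (hG : IsMetricOn G U) (hx : x ∈ U)
    (h : G x = (jacobian φ x)ᵀ * G' (φ x) * jacobian φ x) : IsUnit (jacobian φ x).det := by
  have := hG.det_ne_zero hx
  rw [h, Matrix.det_mul] at this
  exact isUnit_iff_ne_zero.2 (right_ne_zero_of_mul this)

/-- The transformation law of the Christoffel symbols. -/
lemma IsMetricOn.jacobian_mul_connMatrix (hG : IsMetricOn G U) (hG' : IsMetricOn G' U')
    (hx : x ∈ U) (hx' : φ x ∈ U') (hφ : ContDiffAt ℝ ∞ φ x)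
    (h : ∀ᶠ y in 𝓝 x, G y = (jacobian φ y)ᵀ * G' (φ y) * jacobian φ y) (i : Fin n) :
    jacobian φ x * connMatrix G i x
      = pullConn φ (connMatrix G') i x * jacobian φ x + matDeriv i (jacobian φ) x := by
  have hJ := smoothMatAt_jacobian hφ
  have hJu := hG.isUnit_det_jacobian hx h.self_of_nhds
  have hC := (hG'.smooth _ hx').comp hφ
  -- The gauge transform of the pulled-back connection; being symmetric and metric-compatible, it is
  -- the Levi-Civita connection of `G` by uniqueness.
  set Λ : Fin n → Matrix (Fin n) (Fin n) ℝ := fun i => (jacobian φ x)⁻¹ *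
    (pullConn φ (connMatrix G') i x * jacobian φ x + matDeriv i (jacobian φ) x) with hΛ
  have hJΛ (i : Fin n) : jacobian φ x * Λ i
      = pullConn φ (connMatrix G') i x * jacobian φ x + matDeriv i (jacobian φ) x := by
    rw [hΛ, ← Matrix.mul_assoc, Matrix.mul_nonsing_inv _ hJu, Matrix.one_mul]
  have hsym (i j c : Fin n) : (pullConn φ (connMatrix G') i x * jacobian φ x
      + matDeriv i (jacobian φ) x) c j = (pullConn φ (connMatrix G') j x * jacobian φ x
      + matDeriv j (jacobian φ) x) c i := by
    have h1 : matDeriv i (jacobian φ) x c j = matDeriv j (jacobian φ) x c i :=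
      pderiv_jacobian_comm hφ c i j
    rw [Matrix.add_apply, Matrix.add_apply, h1]
    congr 1
    simp only [Matrix.mul_apply, pullConn, Matrix.sum_apply, Matrix.smul_apply, smul_eq_mul,
      connMatrix, Matrix.of_apply, Finset.sum_mul]
    rw [Finset.sum_comm]
    refine Finset.sum_congr rfl fun a _ => Finset.sum_congr rfl fun b _ => ?_
    rw [hG'.christoffel_comm hx' c a b]
    ring
  rw [hG.connMatrix_unique hx Λ ?_ ?_, hJΛ]
  · intro i j k
    simp only [hΛ, Matrix.mul_apply (M := (jacobian φ x)⁻¹)]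
    exact Finset.sum_congr rfl fun c _ => by rw [hsym]
  · intro l
    have hd : matDeriv l (fun y => G' (φ y)) x = (pullConn φ (connMatrix G') l x)ᵀ * G' (φ x)
        + G' (φ x) * pullConn φ (connMatrix G') l x := by
      rw [matDeriv_comp l hφ (hG'.smooth _ hx')]
      simp only [hG'.matDeriv_eq hx', pullConn, Matrix.transpose_sum, Matrix.transpose_smul,
        Finset.sum_mul, Finset.mul_sum, smul_add, Finset.sum_add_distrib, Matrix.smul_mul,
        Matrix.mul_smul]
    have h1 : G x * Λ l = (jacobian φ x)ᵀ * G' (φ x) * (jacobian φ x * Λ l) := by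
      rw [h.self_of_nhds, Matrix.mul_assoc _ (jacobian φ x)]
    have h2 : (Λ l)ᵀ * G x = (jacobian φ x * Λ l)ᵀ * G' (φ x) * jacobian φ x := by
      rw [h.self_of_nhds, Matrix.transpose_mul (jacobian φ x) (Λ l)]
      simp only [Matrix.mul_assoc]
    rw [h1, h2, hJΛ, matDeriv_congr l h, matDeriv_mul l (hJ.transpose.mul hC) hJ,
      matDeriv_mul l hJ.transpose hC, hd, matDeriv_transpose, Matrix.transpose_add,
      Matrix.transpose_mul]
    noncomm_ring

/-- The vanishing of the Ricci tensor is preserved by isometric changes of coordinates. -/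
theorem IsMetricOn.ricci_eq_zero_of_comp (hG : IsMetricOn G U) (hG' : IsMetricOn G' U')
    (hx : x ∈ U) (hφ : ∀ᶠ y in 𝓝 x, ContDiffAt ℝ ∞ φ y) (hφU : ∀ᶠ y in 𝓝 x, φ y ∈ U')
    (h : ∀ᶠ y in 𝓝 x, G y = (jacobian φ y)ᵀ * G' (φ y) * jacobian φ y)
    (h0 : ∀ a b, ricci G' a b (φ x) = 0) (j k : Fin n) : ricci G j k x = 0 := by
  have hφx := hφ.self_of_nhds
  have hx' := hφU.self_of_nhds
  have hJu := hG.isUnit_det_jacobian hx h.self_of_nhds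
  have hcurv (i : Fin n) := mul_connCurv_of_gauge (hG.smooth_connMatrix hx)
    (smoothMatAt_pullConn hφx (hG'.smooth_connMatrix hx')) (smoothMatAt_jacobian hφx)
    (by
      filter_upwards [hG.eventually_mem hx, hφ, hφU, h.eventually_nhds] with y hy hy1 hy2 hy3 i
      exact hG.jacobian_mul_connMatrix hG' hy hy2 hy1 hy3 i) i j
  set J := jacobian φ x
  set D : Fin n → Matrix (Fin n) (Fin n) ℝ :=
    fun a => ∑ b, J b j • connCurv (connMatrix G') a b (φ x) with hD
  have hR (i : Fin n) : connCurv (connMatrix G) i j x = ∑ a, J a i • (J⁻¹ * (D a * J)) := by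
    have h1 := hcurv i
    rw [connCurv_pullConn hφx (hG'.smooth_connMatrix hx')] at h1
    have h2 := congrArg (fun B => J⁻¹ * B) h1
    simp only [← Matrix.mul_assoc, Matrix.nonsing_inv_mul _ hJu, Matrix.one_mul] at h2
    rw [h2]
    simp only [Finset.sum_mul, Finset.mul_sum, Matrix.mul_smul, Matrix.smul_mul,
      Matrix.mul_assoc, hD]
    rfl
  rw [ricci_eq_sum_connCurv]
  -- Contracting the upper index with `i` cancels `J` against `J⁻¹`, which leaves the tensorial law
  -- for Ricci.
  calc ∑ i, connCurv (connMatrix G) i j x i k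
      = ∑ a, (J * (J⁻¹ * (D a * J))) a k := by
        simp only [hR, Matrix.sum_apply, Matrix.smul_apply, smul_eq_mul]
        rw [Finset.sum_comm]
        exact Finset.sum_congr rfl fun a _ => (Matrix.mul_apply ..).symm
    _ = ∑ a, (D a * J) a k := by
        simp only [← Matrix.mul_assoc, Matrix.mul_nonsing_inv _ hJu, Matrix.one_mul]
    _ = ∑ d, (∑ b, J b j * ricci G' b d (φ x)) * J d k := by
        simp only [Matrix.mul_apply, hD, Matrix.sum_apply, Matrix.smul_apply, smul_eq_mul,
          ricci_eq_sum_connCurv, Finset.mul_sum]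
        rw [Finset.sum_comm]
        refine Finset.sum_congr rfl fun d _ => ?_
        rw [← Finset.sum_mul, Finset.sum_comm]
    _ = 0 := by simp [h0]

end LocalMetric

section Manifold

open Filter Topology LocalMetric Matrix

variable {n : ℕ} {M : Type*} [TopologicalSpace M] [ChartedSpace (EuclideanSpace ℝ (Fin n)) M]
  {e e' : OpenPartialHomeomorph M (EuclideanSpace ℝ (Fin n))}
  {x : EuclideanSpace ℝ (Fin n)}

/-! ### Coordinate vector fields and the metric in a chart -/

lemma contDiffAt_transition (he : e ∈ IsManifold.maximalAtlas (𝓡 n) ∞ M)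
    (he' : e' ∈ IsManifold.maximalAtlas (𝓡 n) ∞ M)
    (hx : x ∈ e.target) (hx' : e.symm x ∈ e'.source) : ContDiffAt ℝ ∞ (e' ∘ e.symm) x :=
  ((contMDiffAt_of_mem_maximalAtlas he' hx').comp x
    (contMDiffAt_symm_of_mem_maximalAtlas he hx)).contDiffAt

lemma mfderiv_comp_mfderiv_symm (he : e ∈ IsManifold.maximalAtlas (𝓡 n) ∞ M)
    (hx : x ∈ e.target) :
    (mfderiv (𝓡 n) (𝓡 n) e (e.symm x)).comp (mfderiv (𝓡 n) (𝓡 n) e.symm x)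
      = ContinuousLinearMap.id ℝ (TangentSpace (𝓡 n) x) :=
  OpenPartialHomeomorph.MDifferentiable.comp_symm_deriv
    ⟨fun p hp => ((contMDiffAt_of_mem_maximalAtlas he hp).mdifferentiableAt
        (by simp)).mdifferentiableWithinAt,
      fun p hp => ((contMDiffAt_symm_of_mem_maximalAtlas he hp).mdifferentiableAt
        (by simp)).mdifferentiableWithinAt⟩ hx

lemma mfderiv_symm_comp_mfderiv (he : e ∈ IsManifold.maximalAtlas (𝓡 n) ∞ M) {p : M}
    (hp : p ∈ e.source) :
    (mfderiv (𝓡 n) (𝓡 n) e.symm (e p)).comp (mfderiv (𝓡 n) (𝓡 n) e p)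
      = ContinuousLinearMap.id ℝ (TangentSpace (𝓡 n) p) :=
  OpenPartialHomeomorph.MDifferentiable.symm_comp_deriv
    ⟨fun p hp => ((contMDiffAt_of_mem_maximalAtlas he hp).mdifferentiableAt
        (by simp)).mdifferentiableWithinAt,
      fun p hp => ((contMDiffAt_symm_of_mem_maximalAtlas he hp).mdifferentiableAt
        (by simp)).mdifferentiableWithinAt⟩ hp

lemma mfderiv_symm_eq_sum (x v : EuclideanSpace ℝ (Fin n)) :
    mfderiv (𝓡 n) (𝓡 n) e.symm x v = ∑ i, v i • coordVec e i x := by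
  have hv : v = ∑ k, v k • EuclideanSpace.single k (1 : ℝ) := by
    ext i
    simp [Finset.sum_apply, Pi.single_apply]
  conv_lhs => rw [hv]
  exact (map_sum (mfderiv (𝓡 n) (𝓡 n) e.symm x) _ _).trans
    (Finset.sum_congr rfl fun i _ => map_smul (mfderiv (𝓡 n) (𝓡 n) e.symm x) _ _)

/-- Chain rule for the transition map. The ascription to the model space allows comparing vectors
whose base points `e.symm x` and `e'.symm (e' (e.symm x))` are only propositionally equal. -/
lemma coordVec_eq_sum (he : e ∈ IsManifold.maximalAtlas (𝓡 n) ∞ M)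
    (he' : e' ∈ IsManifold.maximalAtlas (𝓡 n) ∞ M)
    (hx : x ∈ e.target) (hx' : e.symm x ∈ e'.source) (i : Fin n) :
    (coordVec e i x : EuclideanSpace ℝ (Fin n))
      = ∑ a, jacobian (e' ∘ e.symm) x a i • coordVec e' a (e' (e.symm x)) := by
  have hd : fderiv ℝ (e' ∘ e.symm) x (EuclideanSpace.single i 1)
      = mfderiv (𝓡 n) (𝓡 n) e' (e.symm x) (coordVec e i x) := by
    rw [← mfderiv_eq_fderiv, mfderiv_comp x
      ((contMDiffAt_of_mem_maximalAtlas he' hx').mdifferentiableAt (by simp))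
      ((contMDiffAt_symm_of_mem_maximalAtlas he hx).mdifferentiableAt (by simp))]
    rfl
  have h1 : mfderiv (𝓡 n) (𝓡 n) e'.symm (e' (e.symm x))
      (mfderiv (𝓡 n) (𝓡 n) e' (e.symm x) (coordVec e i x)) = coordVec e i x :=
    congrArg (fun L => L (coordVec e i x)) (mfderiv_symm_comp_mfderiv he' hx')
  rw [← hd, mfderiv_symm_eq_sum] at h1
  refine h1.symm.trans (Finset.sum_congr rfl fun a _ => ?_)
  rw [fderiv_single_apply (contDiffAt_transition he he' hx hx')]

lemma bilin_sum_smul (B : EuclideanSpace ℝ (Fin n) →L[ℝ] EuclideanSpace ℝ (Fin n) →L[ℝ] ℝ)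
    (v w : Fin n → ℝ) (c : Fin n → EuclideanSpace ℝ (Fin n)) :
    B (∑ i, v i • c i) (∑ j, w j • c j) = ∑ i, ∑ j, v i * (B (c i) (c j) * w j) := by
  simp only [map_sum, map_smul, _root_.sum_apply, _root_.smul_apply, smul_eq_mul, Finset.mul_sum]
  rw [Finset.sum_comm]
  exact Finset.sum_congr rfl fun i _ => Finset.sum_congr rfl fun j _ => by ring

variable [IsManifold (𝓡 n) ∞ M]

lemma contMDiffAt_coordVec (he : e ∈ IsManifold.maximalAtlas (𝓡 n) ∞ M) (hx : x ∈ e.target)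
    (k : Fin n) :
    ContMDiffAt (𝓡 n) ((𝓡 n).prod (𝓡 n)) ∞
      (fun y => TotalSpace.mk' (EuclideanSpace ℝ (Fin n)) (E := fun p : M => TangentSpace (𝓡 n) p)
        (e.symm y) (coordVec e k y)) x := by
  have hs := contMDiffAt_symm_of_mem_maximalAtlas he hx
  have h : ContMDiffAt (𝓡 n) ((𝓡 n).prod (𝓡 n)) ∞
      (fun y => TotalSpace.mk' (EuclideanSpace ℝ (Fin n))
        (E := fun p : EuclideanSpace ℝ (Fin n) => TangentSpace (𝓡 n) p) y
        (EuclideanSpace.single k (1 : ℝ))) x :=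
    contMDiffAt_vectorSpace_iff_contDiffAt.2 contDiffAt_const
  exact ContMDiffAt.clm_apply_of_inCoordinates
    (hs.mfderiv_const (m := ∞) (by simp)) h hs

lemma contDiffAt_metricInChart
    (g : ContMDiffRiemannianMetric (𝓡 n) ∞ (EuclideanSpace ℝ (Fin n))
      (fun p : M => TangentSpace (𝓡 n) p))
    (he : e ∈ IsManifold.maximalAtlas (𝓡 n) ∞ M) (hx : x ∈ e.target) :
    SmoothMatAt (metricInChart g e) x := by
  intro i j
  have hs := contMDiffAt_symm_of_mem_maximalAtlas he hx
  have : ContMDiffAt (𝓡 n) ((𝓡 n).prod 𝓘(ℝ)) ∞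
      (fun y => TotalSpace.mk' ℝ (E := Bundle.Trivial M ℝ) (e.symm y)
        (g.inner (e.symm y) (coordVec e i y) (coordVec e j y))) x := by
    apply ContMDiffAt.clm_bundle_apply₂ (F₁ := EuclideanSpace ℝ (Fin n))
      (F₂ := EuclideanSpace ℝ (Fin n))
    · exact ContMDiffAt.comp x g.contMDiff.contMDiffAt hs
    · exact contMDiffAt_coordVec he hx i
    · exact contMDiffAt_coordVec he hx j
  rw [contMDiffAt_totalSpace] at this
  exact this.2.contDiffAt

lemma contDiffAt_oneForm_coordVec {β : (p : M) → TangentSpace (𝓡 n) p →L[ℝ] ℝ}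
    (hβ : IsSmoothOneForm β)
    (he : e ∈ IsManifold.maximalAtlas (𝓡 n) ∞ M) (hx : x ∈ e.target) (k : Fin n) :
    ContDiffAt ℝ ∞ (fun y => β (e.symm y) (coordVec e k y)) x := by
  have hs := contMDiffAt_symm_of_mem_maximalAtlas he hx
  have : ContMDiffAt (𝓡 n) ((𝓡 n).prod 𝓘(ℝ)) ∞
      (fun y => TotalSpace.mk' ℝ (E := Bundle.Trivial M ℝ) (e.symm y)
        (β (e.symm y) (coordVec e k y))) x := by
    apply ContMDiffAt.clm_bundle_apply (F₁ := EuclideanSpace ℝ (Fin n))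
    · exact ContMDiffAt.comp x hβ.contMDiffAt hs
    · exact contMDiffAt_coordVec he hx k
  rw [contMDiffAt_totalSpace] at this
  exact this.2.contDiffAt

lemma isMetricOn_metricInChart
    (g : ContMDiffRiemannianMetric (𝓡 n) ∞ (EuclideanSpace ℝ (Fin n))
      (fun p : M => TangentSpace (𝓡 n) p))
    (he : e ∈ IsManifold.maximalAtlas (𝓡 n) ∞ M) : IsMetricOn (metricInChart g e) e.target := by
  have hsymm (x) : (metricInChart g e x)ᵀ = metricInChart g e x := by
    ext i j
    exact g.symm _ _ _
  refine ⟨e.open_target, fun x hx => contDiffAt_metricInChart g he hx, fun x _ => hsymm x,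
    fun x hx => ?_⟩
  refine Matrix.PosDef.of_dotProduct_mulVec_pos (by simpa [Matrix.IsHermitian] using hsymm x)
    fun v hv => ?_
  set w : EuclideanSpace ℝ (Fin n) := WithLp.toLp 2 v
  -- The differential of `e.symm` has a left inverse, so the coordinate vectors are independent and
  -- `g` stays positive on them.
  have hw : mfderiv (𝓡 n) (𝓡 n) e.symm x w ≠ 0 := by
    intro h0
    have h1 := congrArg (fun L => L w) (mfderiv_comp_mfderiv_symm he hx)
    have h2 : mfderiv (𝓡 n) (𝓡 n) e (e.symm x) (mfderiv (𝓡 n) (𝓡 n) e.symm x w) = w := h1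
    rw [h0, map_zero] at h2
    apply hv
    ext i
    exact congrArg (fun u : EuclideanSpace ℝ (Fin n) => u i) h2.symm
  have h := g.pos (e.symm x) _ hw
  rw [mfderiv_symm_eq_sum] at h
  refine h.trans_eq
    ((bilin_sum_smul (g.inner (e.symm x)) v v fun i => coordVec e i x).trans ?_)
  simp only [dotProduct, Matrix.mulVec, Finset.mul_sum]
  rfl

/-- The metric in two overlapping charts. -/
lemma metricInChart_eq (g : ContMDiffRiemannianMetric (𝓡 n) ∞ (EuclideanSpace ℝ (Fin n))
      (fun p : M => TangentSpace (𝓡 n) p))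
    (he : e ∈ IsManifold.maximalAtlas (𝓡 n) ∞ M) (he' : e' ∈ IsManifold.maximalAtlas (𝓡 n) ∞ M)
    (hx : x ∈ e.target) (hx' : e.symm x ∈ e'.source) :
    metricInChart g e x = (jacobian (e' ∘ e.symm) x)ᵀ * metricInChart g e' (e' (e.symm x))
      * jacobian (e' ∘ e.symm) x := by
  have hpt {p q : M} (hpq : p = q) (u w : EuclideanSpace ℝ (Fin n)) :
      g.inner p u w = g.inner q u w := by
    subst hpq
    rfl
  ext i j
  have h1 : metricInChart g e x i j
      = g.inner (e.symm x) (coordVec e i x) (coordVec e j x) := rfl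
  rw [h1, coordVec_eq_sum he he' hx hx' i, coordVec_eq_sum he he' hx hx' j]
  refine (bilin_sum_smul (g.inner (e.symm x)) _ _
    fun a => coordVec e' a (e' (e.symm x))).trans ?_
  rw [Matrix.mul_assoc, Matrix.mul_apply]
  refine Finset.sum_congr rfl fun a _ => ?_
  rw [Matrix.mul_apply, Finset.mul_sum]
  refine Finset.sum_congr rfl fun b _ => ?_
  have h2 : metricInChart g e' (e' (e.symm x)) a b
      = g.inner (e'.symm (e' (e.symm x))) (coordVec e' a (e' (e.symm x)))
        (coordVec e' b (e' (e.symm x))) := rfl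
  rw [h2, Matrix.transpose_apply]
  congr 2
  exact hpt (e'.left_inv hx').symm _ _

end Manifold

section Manifold

open Filter Topology LocalMetric Matrix

variable {n : ℕ} {M : Type*} [TopologicalSpace M] [ChartedSpace (EuclideanSpace ℝ (Fin n)) M]
  {e e' : OpenPartialHomeomorph M (EuclideanSpace ℝ (Fin n))}
  {x : EuclideanSpace ℝ (Fin n)}

/-! ### The zero set of the Ricci tensor -/

lemma oneForm_eq_zero_of_coordVec {β : (p : M) → TangentSpace (𝓡 n) p →L[ℝ] ℝ}
    (he : e ∈ IsManifold.maximalAtlas (𝓡 n) ∞ M) {p : M} (hp : p ∈ e.source)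
    (h : ∀ l, β (e.symm (e p)) (coordVec e l (e p)) = 0) : β p = 0 := by
  have hpt {p q : M} (hpq : p = q) (u : EuclideanSpace ℝ (Fin n)) : β p u = β q u := by
    subst hpq
    rfl
  refine ContinuousLinearMap.ext fun v => ?_
  have h1 : mfderiv (𝓡 n) (𝓡 n) e.symm (e p) (mfderiv (𝓡 n) (𝓡 n) e p v) = v :=
    congrArg (fun L => L v) (mfderiv_symm_comp_mfderiv he hp)
  have h2 := (mfderiv_symm_eq_sum (e := e) (e p) (mfderiv (𝓡 n) (𝓡 n) e p v)).symm.trans h1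
  refine (hpt (e.left_inv hp).symm v).trans ?_
  refine (congrArg (fun u : EuclideanSpace ℝ (Fin n) => β (e.symm (e p)) u) h2.symm).trans ?_
  refine (map_sum (β (e.symm (e p))) _ _).trans (Finset.sum_eq_zero fun i _ => ?_)
  exact (map_smul (β (e.symm (e p))) _ _).trans (by rw [h i, smul_zero])

variable [IsManifold (𝓡 n) ∞ M]

lemma ricci_metricInChart_eq_zero (g : ContMDiffRiemannianMetric (𝓡 n) ∞ (EuclideanSpace ℝ (Fin n))
      (fun p : M => TangentSpace (𝓡 n) p))
    (he : e ∈ IsManifold.maximalAtlas (𝓡 n) ∞ M) (he' : e' ∈ IsManifold.maximalAtlas (𝓡 n) ∞ M)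
    {p : M} (hp : p ∈ e.source) (hp' : p ∈ e'.source)
    (h : ∀ i j, ricci (metricInChart g e') i j (e' p) = 0) (i j : Fin n) :
    ricci (metricInChart g e) i j (e p) = 0 := by
  have hev : ∀ᶠ y in 𝓝 (e p), y ∈ e.target ∧ e.symm y ∈ e'.source :=
    (e.isOpen_inter_preimage_symm e'.open_source).mem_nhds
      ⟨e.map_source hp, by simpa [e.left_inv hp] using hp'⟩
  refine (isMetricOn_metricInChart g he).ricci_eq_zero_of_comp (isMetricOn_metricInChart g he')
    (φ := e' ∘ e.symm) (e.map_source hp) ?_ ?_ ?_ ?_ i j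
  · exact hev.mono fun y hy => contDiffAt_transition he he' hy.1 hy.2
  · exact hev.mono fun y hy => e'.map_source hy.2
  · exact hev.mono fun y hy => metricInChart_eq g he he' hy.1 hy.2
  · simpa [e.left_inv hp] using h

/-- Vanishing of Ricci may be tested in any single chart, since it is preserved by transition maps.
-/
lemma not_ricciNeZeroAt_iff (g : ContMDiffRiemannianMetric (𝓡 n) ∞ (EuclideanSpace ℝ (Fin n))
      (fun p : M => TangentSpace (𝓡 n) p))
    (he : e ∈ IsManifold.maximalAtlas (𝓡 n) ∞ M) {p : M} (hp : p ∈ e.source) :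
    ¬ RicciNeZeroAt g p ↔ ∀ i j, ricci (metricInChart g e) i j (e p) = 0 := by
  constructor
  · intro h i j
    by_contra h0
    exact h ⟨e, he, hp, i, j, h0⟩
  · rintro h ⟨e', he', hp', i, j, h0⟩
    exact h0 (ricci_metricInChart_eq_zero g he' he hp' hp h i j)

lemma isOpen_ricciNeZeroAt (g : ContMDiffRiemannianMetric (𝓡 n) ∞ (EuclideanSpace ℝ (Fin n))
      (fun p : M => TangentSpace (𝓡 n) p)) : IsOpen {p | RicciNeZeroAt g p} := by
  rw [isOpen_iff_eventually]
  rintro p ⟨e, he, hp, i, j, h0⟩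
  have hc : ContinuousAt (ricci (metricInChart g e) i j) (e p) :=
    ((isMetricOn_metricInChart g he).smooth_ricciMatrix (e.map_source hp) i j).continuousAt
  filter_upwards [(e.continuousAt hp).eventually (hc.eventually_ne h0),
    e.open_source.mem_nhds hp] with q hq hqs
  exact ⟨e, he, hqs, i, j, hq⟩

lemma isOpen_not_ricciNeZeroAt (g : ContMDiffRiemannianMetric (𝓡 n) ∞ (EuclideanSpace ℝ (Fin n))
      (fun p : M => TangentSpace (𝓡 n) p)) (hR : IsRicciRecurrent g) :
    IsOpen {p | ¬ RicciNeZeroAt g p} := by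
  obtain ⟨β, hβ, -, hR⟩ := hR
  rw [isOpen_iff_eventually]
  intro p hp
  set e := chartAt (EuclideanSpace ℝ (Fin n)) p
  have he : e ∈ IsManifold.maximalAtlas (𝓡 n) ∞ M := IsManifold.chart_mem_maximalAtlas p
  have hps : p ∈ e.source := mem_chart_source _ p
  -- A ball inside the chart image is convex, so segments from `e p` stay in the domain of the ODE
  -- argument.
  obtain ⟨r, hr, hrs⟩ := Metric.isOpen_iff.1 e.open_target (e p) (e.map_source hps)
  have hz := (not_ricciNeZeroAt_iff g he hps).1 hp
  filter_upwards [(e.continuousAt hps).eventually (Metric.ball_mem_nhds _ hr),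
    e.open_source.mem_nhds hps] with q hq hqs
  refine (not_ricciNeZeroAt_iff g he hqs).2 ?_
  refine (isMetricOn_metricInChart g he).ricci_eq_zero_of_segment
    (b := fun l y => β (e.symm y) (coordVec e l y))
    (fun l y hy => (contDiffAt_oneForm_coordVec hβ he hy l).continuousAt.continuousWithinAt)
    (hR e he) ?_ hz
  exact ((convex_ball (e p) r).segment_subset (Metric.mem_ball_self hr) hq).trans hrs

end Manifold

end
theorem mainTheorem4 {n : ℕ} (hn : 3 ≤ n) {M : Type*} [TopologicalSpace M]
    [ChartedSpace (EuclideanSpace ℝ (Fin n)) M] [IsManifold (𝓡 n) ∞ M]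
    (g : ContMDiffRiemannianMetric (𝓡 n) ∞ (EuclideanSpace ℝ (Fin n))
      (fun p : M => TangentSpace (𝓡 n) p))
    (hRi : ∀ p : M, ∃ q ∈ connectedComponent p, RicciNeZeroAt g q) :
    ¬ (IsRicciRecurrent g ∧ IsCotton g) := by
  rintro ⟨hR, hC⟩
  have hclopen : IsClopen {p | ¬ RicciNeZeroAt g p} :=
    ⟨(isOpen_ricciNeZeroAt g).isClosed_compl, isOpen_not_ricciNeZeroAt g hR⟩
  obtain ⟨β, -, ⟨p, hp⟩, hR⟩ := hR
  have he : chartAt (EuclideanSpace ℝ (Fin n)) p ∈ IsManifold.maximalAtlas (𝓡 n) ∞ M :=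
    IsManifold.chart_mem_maximalAtlas p
  have hps := mem_chart_source (EuclideanSpace ℝ (Fin n)) p
  have hpt := mem_chart_target (EuclideanSpace ℝ (Fin n)) p
  obtain ⟨l, hl⟩ := not_forall.1 (mt (oneForm_eq_zero_of_coordVec he hps) hp)
  have hzero : ¬ RicciNeZeroAt g p := (not_ricciNeZeroAt_iff g he hps).2
    ((isMetricOn_metricInChart g he).ricci_eq_zero hn hpt
      (b := fun l y => β ((chartAt (EuclideanSpace ℝ (Fin n)) p).symm y) (coordVec _ l y))
      (hR _ he) (hC _ he _ hpt) hl)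
  obtain ⟨q, hq, hq'⟩ := hRi p
  -- The clopen zero set contains `p`, hence its whole component, including the point `q` where
  -- Ricci is nonzero.
  exact isPreconnected_connectedComponent.subset_isClopen hclopen
    ⟨p, mem_connectedComponent, hzero⟩ hq hq'
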